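/- \textbf{Setting.} Let $J_1,\dots,J_m$ be lower triangular Jordan blocks (entries $\lambda_j$ on the diagonal and $1$ just below it), $J_j$ of size $n_j\ge 1$ with eigenvalue $\lambda_j\in\mathbb C$, and put $n=n_1+\dots+n_m$. Let $D$ be an invertible complex $n\times n$ matrix, $\mathcal D=D\mathbb B^n$ the image of the open Euclidean unit ball of $\mathbb C^n$, $G:[0,1)\to(0,\infty)$ continuous and non-increasing, $H(w)=G(|D^{-1}w|)/|\det D|^2$ on $\mathcal D$, and let $\mathcal H=A^2_H(\mathcal D)$ be the space of analytic $f:\mathcal D\to\mathbb C$ with $\|f\|^2=\int_{\mathcal D}|f|^2H\,dw<\infty$. Let $\varphi:\mathcal D\to\mathcal D$ be analytic with $\varphi(0)=0$ and with $\varphi'(0)=\operatorname{diag}(J_1^t,\dots,J_m^t)$ invertible, and suppose that the composition operator $C_\varphi f=f\circ\varphi$ maps $\mathcal H$ to itself and is compact. The matrix of $C_\varphi$ has as its entry in row $z^\alpha$, column $z^\beta$ the Taylor coefficient of $z^\alpha$ at $0$ of $\varphi^\beta=\varphi_1^{\beta_1}\cdots\varphi_n^{\beta_n}$. Let $K$ be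 so large that no $\lambda_i$ $(1\le i\le m)$ equals a diagonal entry $(\alpha,\alpha)$ of this matrix with $|\alpha|>K$. Let $P$ be the orthogonal projection of $\mathcal H$ onto $P\mathcal H=\operatorname{span}\{z^\alpha:1\le|\alpha|\le K\}$, of dimension $N$, and let $U=PC_\varphi P$, regarded as an operator on $P\mathcal H\cong\mathbb C^N$. A chain of length $k$ and eigenvalue $\lambda$ of a linear operator $L$ is a list of nonzero vectors $e_1,\dots,e_k$ with $(L-\lambda I)e_1=0$ and $(L-\lambda I)e_{i}=e_{i-1}$ for $2\le i\le k$. A Jordan subspace of $L$ with eigenvalue $\lambda$ is an $L$-invariant subspace $S$ that has an $L$-invariant complement and on which $L$ is, in some basis, a single Jordan block of size $\dim S\ge 1$ with eigenvalue $\lambda$. \textbf{Theorem.} For every $j\in\{1,\dots,m\}$ the following are equivalent. \begin{enumerate} \item There is $F_j=(f_1,\dots,f_{n_j})^t$ whose components are linearly independent elements of $\mathcal H$ and which satisfies $F_j\circ\varphi=J_j^tF_j$ on $\mathcal D$. \item There is a decomposition $P\mathcal H=\tilde S_1\oplus\dots\oplus\tilde S_l$ into Jordan subspaces of $U$ such that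 some $\tilde S_k$ has eigenvalue $\lambda_j$ and dimension at least $n_j$. \item $U$ has a Jordan subspace with eigenvalue $\lambda_j$ and dimension at least $n_j$. \item $\ker(U-\lambda_jI)\cap(U-\lambda_jI)^{n_j-1}(P\mathcal H)\ne\{0\}$. \item $U$ has a chain of length $n_j$ and eigenvalue $\lambda_j$. \end{enumerate} Moreover, if $F_j$ is as in (1), then $Pf_{n_j},Pf_{n_j-1},\dots,Pf_1$ is a chain of $U$ with eigenvalue $\lambda_j$. Conversely, for every chain $\epsilon_1,\dots,\epsilon_{n_j}$ of $U$ with eigenvalue $\lambda_j$ there is exactly one $F_j=(f_1,\dots,f_{n_j})^t$ with components in $\mathcal H$ such that $F_j\circ\varphi=J_j^tF_j$ on $\mathcal D$ and $Pf_{n_j+1-i}=\epsilon_i$ for $1\le i\le n_j$, and the components of this $F_j$ are linearly independent. -/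

import Mathlib

open MeasureTheory Topology
open scoped ENNReal

noncomputable section

/-! ### Chains, Jordan blocks, Jordan subspaces -/

/-- The lower triangular Jordan block of size `k` with eigenvalue `lam`. -/
def jordanBlock (k : ℕ) (lam : ℂ) : Matrix (Fin k) (Fin k) ℂ :=
  Matrix.of fun i j => if i = j then lam else if (i : ℕ) = (j : ℕ) + 1 then 1 else 0

/-- The upper triangular Jordan matrix `diag(J₁ᵗ, …, J_mᵗ)`, where `J_j` is the lower triangular
Jordan block of size `d j` with eigenvalue `lam j`. -/
def jordanMatrix {m : ℕ} (d : Fin m → ℕ) (lam : Fin m → ℂ) :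
    Matrix (Fin (∑ j, d j)) (Fin (∑ j, d j)) ℂ :=
  Matrix.reindex finSigmaFinEquiv finSigmaFinEquiv
    (Matrix.blockDiagonal' fun j => (jordanBlock (d j) (lam j)).transpose)

/-- `e₁, …, e_k` (indexed from `0`) is a chain of `L` with eigenvalue `lam`: nonzero vectors with
`(L - lam) e₁ = 0` and `(L - lam) e_{i+1} = e_i`. -/
def IsEigenChain {V : Type*} [AddCommGroup V] [Module ℂ V] (L : Module.End ℂ V) (lam : ℂ) {k : ℕ}
    (e : Fin k → V) : Prop :=
  (∀ i, e i ≠ 0) ∧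
  (∀ i : Fin k, (i : ℕ) = 0 → L (e i) - lam • e i = 0) ∧
  (∀ i i' : Fin k, (i' : ℕ) = (i : ℕ) + 1 → L (e i') - lam • e i' = e i)

/-- `S` is a Jordan subspace of `L` with eigenvalue `lam`: it is `L`-invariant with an
`L`-invariant complement, and in some basis of `S` the restriction of `L` to `S` is a Jordan block
of positive size with eigenvalue `lam`. -/
def IsJordanSubspace {V : Type*} [AddCommGroup V] [Module ℂ V] (L : Module.End ℂ V) (lam : ℂ)
    (S : Submodule ℂ V) : Prop :=
  (∃ T : Submodule ℂ V, IsCompl S T ∧ ∀ x ∈ T, L x ∈ T) ∧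
  ∃ (hS : ∀ x ∈ S, L x ∈ S) (k : ℕ) (b : Module.Basis (Fin k) ℂ S),
    0 < k ∧ LinearMap.toMatrix b b (L.restrict hS) = jordanBlock k lam

/-- `V = S₁ ⊕ … ⊕ S_l` is a decomposition into Jordan subspaces of `L`, where `S_k` has
eigenvalue `ζ k`. -/
def IsJordanDecomposition {V : Type*} [AddCommGroup V] [Module ℂ V] (L : Module.End ℂ V) {l : ℕ}
    (S : Fin l → Submodule ℂ V) (ζ : Fin l → ℂ) : Prop :=
  DirectSum.IsInternal S ∧ ∀ k, IsJordanSubspace L (ζ k) (S k)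

/-! ### Ellipsoids and weighted Bergman spaces -/

variable {n : ℕ}

/-- The ellipsoid `D 𝔹ⁿ`. -/
def ellipsoid (D : GL (Fin n) ℂ) : Set (EuclideanSpace ℂ (Fin n)) :=
  Matrix.toEuclideanCLM (𝕜 := ℂ) (D : Matrix (Fin n) (Fin n) ℂ) '' Metric.ball 0 1

/-- A continuous, non-increasing weight `G : [0,1) → (0,∞)` (values outside `[0,1)` are not used). -/
structure RadialWeight where
  toFun : ℝ → ℝ
  pos : ∀ r ∈ Set.Ico (0 : ℝ) 1, 0 < toFun r
  continuousOn : ContinuousOn toFun (Set.Ico 0 1)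
  antitoneOn : AntitoneOn toFun (Set.Ico 0 1)

/-- The weight `H(w) = G(|D⁻¹ w|) / |det D|²` on the ellipsoid `D 𝔹ⁿ`. -/
def ellipsoidWeight (D : GL (Fin n) ℂ) (G : RadialWeight) (w : EuclideanSpace ℂ (Fin n)) : ℝ :=
  G.toFun ‖Matrix.toEuclideanCLM (𝕜 := ℂ) ((D⁻¹ : GL (Fin n) ℂ) : Matrix (Fin n) (Fin n) ℂ) w‖
    / ‖(D : Matrix (Fin n) (Fin n) ℂ).det‖ ^ 2

/-- The measure `H(w) dw` on the ellipsoid. -/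
def bergmanMeasure (D : GL (Fin n) ℂ) (G : RadialWeight) : Measure (EuclideanSpace ℂ (Fin n)) :=
  (volume.restrict (ellipsoid D)).withDensity fun w => ENNReal.ofReal (ellipsoidWeight D G w)

theorem toEuclideanCLM_inv_apply (D : GL (Fin n) ℂ) (x : EuclideanSpace ℂ (Fin n)) :
    Matrix.toEuclideanCLM (𝕜 := ℂ) ((D⁻¹ : GL (Fin n) ℂ) : Matrix (Fin n) (Fin n) ℂ)
      (Matrix.toEuclideanCLM (𝕜 := ℂ) (D : Matrix (Fin n) (Fin n) ℂ) x) = x := by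
  rw [← mul_apply_eq_comp, ← map_mul, ← Units.val_mul, inv_mul_cancel]
  simp

theorem mem_ellipsoid_iff (D : GL (Fin n) ℂ) (w : EuclideanSpace ℂ (Fin n)) :
    w ∈ ellipsoid D ↔
      ‖Matrix.toEuclideanCLM (𝕜 := ℂ)
        ((D⁻¹ : GL (Fin n) ℂ) : Matrix (Fin n) (Fin n) ℂ) w‖ < 1 := by
  constructor
  · rintro ⟨x, hx, rfl⟩
    rw [toEuclideanCLM_inv_apply]
    simpa using hx
  · intro h
    refine ⟨_, mem_ball_zero_iff.2 h, ?_⟩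
    have := toEuclideanCLM_inv_apply D⁻¹ w
    rw [inv_inv] at this
    exact this

theorem isOpen_ellipsoid (D : GL (Fin n) ℂ) : IsOpen (ellipsoid D) := by
  have : ellipsoid D = {w | ‖Matrix.toEuclideanCLM (𝕜 := ℂ)
        ((D⁻¹ : GL (Fin n) ℂ) : Matrix (Fin n) (Fin n) ℂ) w‖ < 1} := by
    ext w; exact mem_ellipsoid_iff D w
  rw [this]
  exact isOpen_lt (by fun_prop) continuous_const

theorem isBounded_ellipsoid (D : GL (Fin n) ℂ) : Bornology.IsBounded (ellipsoid D) :=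
  (Matrix.toEuclideanCLM (𝕜 := ℂ) (D : Matrix (Fin n) (Fin n) ℂ)).lipschitz.isBounded_image
    Metric.isBounded_ball

theorem det_norm_pos (D : GL (Fin n) ℂ) : 0 < ‖(D : Matrix (Fin n) (Fin n) ℂ).det‖ ^ 2 := by
  have h : IsUnit (D : Matrix (Fin n) (Fin n) ℂ).det :=
    (Matrix.isUnit_iff_isUnit_det _).1 D.isUnit
  have := norm_pos_iff.2 h.ne_zero
  positivity

theorem ellipsoidWeight_pos (D : GL (Fin n) ℂ) (G : RadialWeight)
    {w : EuclideanSpace ℂ (Fin n)} (hw : w ∈ ellipsoid D) : 0 < ellipsoidWeight D G w :=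
  div_pos (G.pos _ ⟨norm_nonneg _, (mem_ellipsoid_iff D w).1 hw⟩) (det_norm_pos D)

theorem ellipsoidWeight_continuousOn (D : GL (Fin n) ℂ) (G : RadialWeight) :
    ContinuousOn (ellipsoidWeight D G) (ellipsoid D) := by
  refine ContinuousOn.div_const ?_ _
  refine G.continuousOn.comp (by fun_prop) ?_
  intro w hw
  exact ⟨norm_nonneg _, (mem_ellipsoid_iff D w).1 hw⟩

instance (D : GL (Fin n) ℂ) (G : RadialWeight) : IsFiniteMeasure (bergmanMeasure D G) := by
  refine isFiniteMeasure_withDensity ?_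
  set c : ℝ := G.toFun 0 / ‖(D : Matrix (Fin n) (Fin n) ℂ).det‖ ^ 2
  have hle : ∀ w ∈ ellipsoid D, ENNReal.ofReal (ellipsoidWeight D G w) ≤ ENNReal.ofReal c := by
    intro w hw
    refine ENNReal.ofReal_le_ofReal ?_
    refine div_le_div_of_nonneg_right ?_ (det_norm_pos D).le
    exact G.antitoneOn ⟨le_rfl, zero_lt_one⟩
      ⟨norm_nonneg _, (mem_ellipsoid_iff D w).1 hw⟩ (norm_nonneg _)
  refine ne_of_lt (lt_of_le_of_lt (setLIntegral_mono' (isOpen_ellipsoid D).measurableSet hle) ?_)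
  rw [setLIntegral_const]
  exact ENNReal.mul_lt_top ENNReal.ofReal_lt_top (isBounded_ellipsoid D).measure_lt_top

theorem restrict_absolutelyContinuous (D : GL (Fin n) ℂ) (G : RadialWeight) :
    volume.restrict (ellipsoid D) ≪ bergmanMeasure D G := by
  refine withDensity_absolutelyContinuous' ?_ ?_
  · exact ((ellipsoidWeight_continuousOn D G).aemeasurable
      (isOpen_ellipsoid D).measurableSet).ennreal_ofReal
  · refine (ae_restrict_iff' (isOpen_ellipsoid D).measurableSet).2 (.of_forall fun w hw => ?_)
    simpa using ellipsoidWeight_pos D G hw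

/-- `f` is analytic on the ellipsoid `D 𝔹ⁿ` and square integrable there with respect to `H(w) dw`.
A function on the ellipsoid is represented by its extension by `0`. -/
def MemBergman (D : GL (Fin n) ℂ) (G : RadialWeight) (f : EuclideanSpace ℂ (Fin n) → ℂ) : Prop :=
  AnalyticOnNhd ℂ f (ellipsoid D) ∧ MemLp f 2 (bergmanMeasure D G) ∧ ∀ z ∉ ellipsoid D, f z = 0

/-- The functions satisfying `MemBergman`, as a subspace. -/
def bergmanSubmodule (D : GL (Fin n) ℂ) (G : RadialWeight) :
    Submodule ℂ (EuclideanSpace ℂ (Fin n) → ℂ) where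
  carrier := {f | MemBergman D G f}
  zero_mem' := ⟨analyticOnNhd_const, MemLp.zero, fun _ _ => rfl⟩
  add_mem' := fun {f g} hf hg => ⟨hf.1.add hg.1, hf.2.1.add hg.2.1, fun z hz => by
    simp [hf.2.2 z hz, hg.2.2 z hz]⟩
  smul_mem' := fun c f hf => ⟨(analyticOnNhd_const (v := c)).smul hf.1, hf.2.1.const_smul c, fun z hz => by
    simp [hf.2.2 z hz]⟩

/-- The weighted Bergman space `A²_H(D 𝔹ⁿ)`. -/
def Bergman (D : GL (Fin n) ℂ) (G : RadialWeight) : Type := bergmanSubmodule D G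

namespace Bergman

variable {D : GL (Fin n) ℂ} {G : RadialWeight}

instance : AddCommGroup (Bergman D G) := inferInstanceAs (AddCommGroup (bergmanSubmodule D G))

instance : Module ℂ (Bergman D G) := inferInstanceAs (Module ℂ (bergmanSubmodule D G))

theorem mem (f : Bergman D G) : MemBergman D G f.1 := f.2

instance : CoeFun (Bergman D G) fun _ => EuclideanSpace ℂ (Fin n) → ℂ := ⟨Subtype.val⟩

/-- The inclusion of the Bergman space in `L²(H(w) dw)`. -/
def toL2 (D : GL (Fin n) ℂ) (G : RadialWeight) :
    Bergman D G →ₗ[ℂ] Lp ℂ 2 (bergmanMeasure D G) where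
  toFun f := f.mem.2.1.toLp f.1
  map_add' f g := MemLp.toLp_add f.mem.2.1 g.mem.2.1
  map_smul' c f := MemLp.toLp_const_smul c f.mem.2.1

theorem toL2_injective : Function.Injective (toL2 D G) := by
  intro f g h
  have h1 : f.1 =ᵐ[bergmanMeasure D G] g.1 := (MemLp.toLp_eq_toLp_iff f.mem.2.1 g.mem.2.1).1 h
  have h2 : f.1 =ᵐ[volume.restrict (ellipsoid D)] g.1 :=
    (restrict_absolutelyContinuous D G).ae_eq h1
  have h3 := Measure.eqOn_open_of_ae_eq h2 (isOpen_ellipsoid D) f.mem.1.continuousOn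
    g.mem.1.continuousOn
  refine Subtype.ext (funext fun z => ?_)
  by_cases hz : z ∈ ellipsoid D
  · exact h3 hz
  · rw [f.mem.2.2 z hz, g.mem.2.2 z hz]

/-- The norm is the one of `L²(H(w) dw)`. -/
instance : NormedAddCommGroup (Bergman D G) :=
  NormedAddCommGroup.induced (Bergman D G) (Lp ℂ 2 (bergmanMeasure D G)) (toL2 D G) toL2_injective

/-- The inner product is the one of `L²(H(w) dw)`. -/
instance : InnerProductSpace ℂ (Bergman D G) :=
  InnerProductSpace.induced (toL2 D G)

theorem monomial_mem (D : GL (Fin n) ℂ) (G : RadialWeight) (α : Fin n →₀ ℕ) :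
    MemBergman D G ((ellipsoid D).indicator fun z => ∏ i, z i ^ α i) := by
  have hc : Continuous fun z : EuclideanSpace ℂ (Fin n) => ∏ i, z i ^ α i := by fun_prop
  have ha : AnalyticOnNhd ℂ (fun z : EuclideanSpace ℂ (Fin n) => ∏ i, z i ^ α i)
      (ellipsoid D) := by
    refine Finset.analyticOnNhd_fun_prod _ fun i _ => AnalyticOnNhd.pow ?_ _
    exact (EuclideanSpace.proj (𝕜 := ℂ) i).analyticOnNhd _
  have he : Set.EqOn (fun z : EuclideanSpace ℂ (Fin n) => ∏ i, z i ^ α i)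
      ((ellipsoid D).indicator fun z => ∏ i, z i ^ α i) (ellipsoid D) :=
    (Set.eqOn_indicator (s := ellipsoid D)).symm
  refine ⟨ha.congr (isOpen_ellipsoid D) he, ?_, fun z hz => Set.indicator_of_notMem hz _⟩
  obtain ⟨C, hC⟩ := (isBounded_ellipsoid D).isCompact_closure.exists_bound_of_continuousOn
    hc.continuousOn
  refine MemLp.of_bound (C := max C 0) ?_ (.of_forall fun z => ?_)
  · exact (hc.measurable.indicator (isOpen_ellipsoid D).measurableSet).aestronglyMeasurable
  · by_cases hz : z ∈ ellipsoid D
    · rw [Set.indicator_of_mem hz]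
      exact (hC z (subset_closure hz)).trans (le_max_left _ _)
    · rw [Set.indicator_of_notMem hz]
      simp

/-- The monomial `z^α` as an element of the Bergman space. -/
def monomial (D : GL (Fin n) ℂ) (G : RadialWeight) (α : Fin n →₀ ℕ) : Bergman D G :=
  ⟨_, monomial_mem D G α⟩

/-- The span `⟨z₁, …, z_n, z₁², z₁z₂, …, z_n^K⟩` of the monomials `z^α` with `1 ≤ |α| ≤ K`. -/
def polySpace (D : GL (Fin n) ℂ) (G : RadialWeight) (K : ℕ) : Submodule ℂ (Bergman D G) :=
  Submodule.span ℂ (monomial D G '' {α | 1 ≤ α.degree ∧ α.degree ≤ K})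

instance (K : ℕ) : FiniteDimensional ℂ (polySpace D G K) :=
  FiniteDimensional.span_of_finite ℂ
    (((Finsupp.finite_of_degree_le K).subset fun _ h => h.2).image _)

/-- The orthogonal projection `P` of the Bergman space onto `polySpace D G K`. -/
def proj (D : GL (Fin n) ℂ) (G : RadialWeight) (K : ℕ) :
    Bergman D G →ₗ[ℂ] polySpace D G K :=
  (polySpace D G K).orthogonalProjectionOnto.toLinearMap

/-- The composition operator `C_φ f = f ∘ φ` of the Bergman space, for a `φ` such that `f ∘ φ`
belongs to the Bergman space whenever `f` does. -/
def compOp (φ : EuclideanSpace ℂ (Fin n) → EuclideanSpace ℂ (Fin n))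
    (hφ : ∀ f : Bergman D G, MemBergman D G ((ellipsoid D).indicator fun z => f (φ z))) :
    Bergman D G →ₗ[ℂ] Bergman D G where
  toFun f := ⟨_, hφ f⟩
  map_add' f g := Subtype.ext (Set.indicator_add (ellipsoid D) (fun z => f (φ z))
    (fun z => g (φ z)))
  map_smul' c f := Subtype.ext (Set.indicator_const_smul (ellipsoid D) c (fun z => f (φ z)))

/-- The corner `U = P C P` of an operator `C`, acting on `polySpace D G K`. -/
def corner (C : Bergman D G →ₗ[ℂ] Bergman D G) (K : ℕ) : Module.End ℂ (polySpace D G K) :=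
  proj D G K ∘ₗ C ∘ₗ (polySpace D G K).subtype

/-- The block equation `F ∘ φ = Jᵗ F` on the ellipsoid, for the lower triangular Jordan block `J`
of size `k` with eigenvalue `lam` and `F = (f₁, …, f_k)ᵗ` with components in the Bergman space. -/
def IsBlockSolution (φ : EuclideanSpace ℂ (Fin n) → EuclideanSpace ℂ (Fin n)) {k : ℕ} (lam : ℂ)
    (F : Fin k → Bergman D G) : Prop :=
  ∀ z ∈ ellipsoid D,
    (fun i => F i (φ z)) = (jordanBlock k lam).transpose.mulVec (fun i => F i z)

end Bergman

/-- `c` is the coefficient of `z^α` in the Taylor expansion of `g` at `0`: some polynomial agrees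
with `g` up to `O(|z|^(|α|+1))` and has `c` as its coefficient of `z^α`. -/
def IsTaylorCoeff (g : EuclideanSpace ℂ (Fin n) → ℂ) (α : Fin n →₀ ℕ) (c : ℂ) : Prop :=
  ∃ q : MvPolynomial (Fin n) ℂ, q.coeff α = c ∧
    (fun z : EuclideanSpace ℂ (Fin n) => g z - MvPolynomial.eval (fun i => z i) q)
      =O[𝓝 0] fun z => ‖z‖ ^ (α.degree + 1)

/-- `c` is the entry of the matrix of `C_φ` in row `z^α` and column `z^β`: the coefficient of
`z^α` in `φ^β = φ₁^β₁ ⋯ φ_n^β_n`. -/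
def IsCompEntry (φ : EuclideanSpace ℂ (Fin n) → EuclideanSpace ℂ (Fin n)) (α β : Fin n →₀ ℕ)
    (c : ℂ) : Prop :=
  IsTaylorCoeff (fun z => ∏ i, φ z i ^ β i) α c

end

/-! ### Jordan chains and Jordan subspaces -/

/-! Read from the last component to the first, the block equation says that `f_{n_j}, …, f_1`
satisfies the chain equations for `C_φ` with eigenvalue `λ_j`. The theorem thus compares chains of
`C_φ` with chains of its corner `U`; the equivalence of (2)-(5) is the Jordan form of `U`
(`jordan_tfae`).

The comparison rests on the orthogonal complement of `P𝓗`. The measure `H dw` is invariant under `z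
↦ e^{iθ}z`, so `f` is orthogonal to `P𝓗` exactly when `f - f(0) = O(|z|^{K+1})`
(`mem_polySpace_orthogonal_iff`). Since `φ(0) = 0`, composition with `φ` preserves this condition;
hence `P C_φ = U P` (`proj_compOp`) and chains project to solutions of the chain equations for `U`.

Lifting back works because `C_φ - λ_j` is bijective on the complement. Injectivity is
`eq_zero_of_compOp_eq_smul`: an eigenfunction there vanishes at `0` because `λ_j ≠ 1`, and its
lowest homogeneous part would be an eigenvector of the substitution by `φ'(0)`. The eigenvalues of
this substitution are diagonal entries of the matrix of `C_φ`, and those of degree above `K` are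
excluded by the choice of `K`. Surjectivity is then the Fredholm alternative, and chains lift
uniquely one vector at a time (`exists_lift`).

That `λ_j ≠ 1` follows from compactness (`ne_one_of_isCompactOperator`): otherwise the normalized
powers of one coordinate would be orthonormal vectors `g_k` with `⟨g_k, C_φ g_k⟩ = 1`. -/

section LinearAlgebra

variable {V : Type*} [AddCommGroup V] [Module ℂ V]

theorem pow_apply_eq_zero_of_le {N : Module.End ℂ V} {k l : ℕ} {w : V} (hkl : k ≤ l)
    (h : (N ^ k) w = 0) : (N ^ l) w = 0 := by
  rw [← Nat.sub_add_cancel hkl, pow_add, Module.End.mul_apply, h, map_zero]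

/-- Applying `N ^ (k - 1 - i)` and then `ξ` to a combination of the `N ^ j w` whose first `i`
coefficients vanish isolates the coefficient of `N ^ i w`. -/
theorem coeff_eq_zero_of_cyclic {W : Type*} [AddCommGroup W] [Module ℂ W] {N : Module.End ℂ V}
    {k : ℕ} {w : V} (ξ : V →ₗ[ℂ] W)
    (hk : (N ^ k) w = 0) (hw : ξ ((N ^ (k - 1)) w) ≠ 0) (a : Fin k → ℂ)
    (h : ∀ i < k, ξ ((N ^ i) (∑ j : Fin k, a j • (N ^ (j : ℕ)) w)) = 0) : a = 0 := by
  have key : ∀ i : ℕ, ∀ hi : i < k, a ⟨i, hi⟩ = 0 := by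
    intro i
    induction i using Nat.strong_induction_on with
    | _ i ih =>
      intro hi
      have h1 := h (k - 1 - i) (by omega)
      rw [map_sum, map_sum, Finset.sum_eq_single ⟨i, hi⟩] at h1
      · rw [map_smul, map_smul, ← Module.End.mul_apply, ← pow_add] at h1
        have : k - 1 - i + i = k - 1 := by omega
        rw [this] at h1
        exact (smul_eq_zero.1 h1).resolve_right hw
      · intro b _ hb
        rcases lt_or_gt_of_ne (fun e => hb (Fin.ext e) : (b : ℕ) ≠ i) with hlt | hgt
        · rw [show a b = 0 from ih b hlt b.2]
          simp
        · rw [map_smul, ← Module.End.mul_apply, ← pow_add,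
            pow_apply_eq_zero_of_le (by omega) hk]
          simp
      · simp
  exact funext fun i => key i i.2

theorem linearIndependent_cyclic {N : Module.End ℂ V} {k : ℕ} {w : V}
    (hk : (N ^ k) w = 0) (hw : (N ^ (k - 1)) w ≠ 0) :
    LinearIndependent ℂ fun i : Fin k => (N ^ (i : ℕ)) w := by
  rw [Fintype.linearIndependent_iff]
  intro a ha i
  have := coeff_eq_zero_of_cyclic (LinearMap.id : V →ₗ[ℂ] V) hk hw a (fun i _ => by simp [ha])
  rw [this]
  rfl

theorem sum_jordanBlock_smul {k : ℕ} (lam : ℂ) (v : Fin k → V) (i : Fin k) :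
    ∑ j, jordanBlock k lam j i • v j =
      lam • v i + if h : (i : ℕ) + 1 < k then v ⟨i + 1, h⟩ else 0 := by
  have h1 : ∀ j : Fin k, jordanBlock k lam j i • v j =
      (if j = i then lam • v j else 0) + (if (j : ℕ) = i + 1 then v j else 0) := by
    intro j
    simp only [jordanBlock, Matrix.of_apply]
    by_cases hji : j = i
    · subst hji; simp
    · by_cases h2 : (j : ℕ) = i + 1 <;> simp [hji, h2]
  simp_rw [h1]
  rw [Finset.sum_add_distrib]
  congr 1
  · simp
  · split_ifs with h
    · rw [Finset.sum_eq_single ⟨(i : ℕ) + 1, h⟩]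
      · simp
      · intro b _ hb
        rw [if_neg (fun e => hb (Fin.ext e))]
      · simp
    · refine Finset.sum_eq_zero fun j _ => if_neg ?_
      have := j.2
      omega

/-- For a lower triangular block, `L - lam` shifts each basis vector to the next, so the first one
generates `S`. This cyclic description replaces matrices in everything below. -/
theorem isJordanSubspace_iff {L : Module.End ℂ V} {lam : ℂ} {S : Submodule ℂ V} :
    IsJordanSubspace L lam S ↔ (∃ T : Submodule ℂ V, IsCompl S T ∧ ∀ x ∈ T, L x ∈ T) ∧
      ∃ (k : ℕ) (w : V), 0 < k ∧ ((L - lam • 1) ^ k) w = 0 ∧ ((L - lam • 1) ^ (k - 1)) w ≠ 0 ∧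
        S = Submodule.span ℂ (Set.range fun i : Fin k => ((L - lam • 1) ^ (i : ℕ)) w) := by
  refine and_congr_right fun _ => ⟨?_, ?_⟩
  · rintro ⟨hS, k, b, hk, hb⟩
    have hN : ∀ i : Fin k, (L - lam • 1) (b i : V) =
        if h : (i : ℕ) + 1 < k then (b ⟨i + 1, h⟩ : V) else 0 := by
      intro i
      have h1 : L.restrict hS (b i) = ∑ j, jordanBlock k lam j i • b j := by
        rw [← Matrix.toLin_self b b, ← hb, Matrix.toLin_toMatrix]
      rw [sum_jordanBlock_smul] at h1
      have h2 := congrArg (Subtype.val) h1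
      rw [LinearMap.coe_restrict_apply] at h2
      rw [LinearMap.sub_apply, h2]
      split_ifs <;> simp
    have hpow : ∀ i : ℕ, ∀ hi : i < k, ((L - lam • 1) ^ i) (b ⟨0, hk⟩ : V) = b ⟨i, hi⟩ := by
      intro i
      induction i with
      | zero => intro hi; simp
      | succ i ih =>
        intro hi
        rw [pow_succ', Module.End.mul_apply, ih (by omega), hN, dif_pos hi]
    refine ⟨k, b ⟨0, hk⟩, hk, ?_, ?_, ?_⟩
    · obtain ⟨k', rfl⟩ : ∃ k', k = k' + 1 := ⟨k - 1, by omega⟩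
      rw [pow_succ', Module.End.mul_apply, hpow k' (by omega), hN, dif_neg (by simp)]
    · rw [hpow (k - 1) (by omega)]
      simpa using b.ne_zero _
    · have h3 : (fun i : Fin k => ((L - lam • 1) ^ (i : ℕ)) (b ⟨0, hk⟩ : V)) =
          fun i => S.subtype (b i) := by
        funext i
        exact hpow i i.2
      rw [h3, Set.range_comp' S.subtype b, ← Submodule.map_span, b.span_eq]
      simp
  · rintro ⟨k, w, hk, hw0, hw1, rfl⟩
    have hli := linearIndependent_cyclic hw0 hw1
    set v : Fin k → V := fun i => ((L - lam • 1) ^ (i : ℕ)) w with hv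
    have hL : ∀ i, L (v i) = ∑ j, jordanBlock k lam j i • v j := by
      intro i
      rw [sum_jordanBlock_smul]
      have : (if h : (i : ℕ) + 1 < k then v ⟨i + 1, h⟩ else 0) = (L - lam • 1) (v i) := by
        rw [hv]
        simp only
        rw [← Module.End.mul_apply, ← pow_succ']
        split_ifs with h
        · rfl
        · rw [pow_apply_eq_zero_of_le (by omega) hw0]
      rw [this]
      simp
    have hS : ∀ x ∈ Submodule.span ℂ (Set.range v), L x ∈ Submodule.span ℂ (Set.range v) := by
      intro x hx
      induction hx using Submodule.span_induction with
      | mem x hx =>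
        obtain ⟨i, rfl⟩ := hx
        rw [hL]
        exact Submodule.sum_mem _ fun j _ =>
          Submodule.smul_mem _ _ (Submodule.subset_span ⟨j, rfl⟩)
      | zero => simp
      | add x y _ _ hx hy => rw [map_add]; exact Submodule.add_mem _ hx hy
      | smul c x _ hx => rw [map_smul]; exact Submodule.smul_mem _ _ hx
    refine ⟨hS, k, Module.Basis.span hli, hk, ?_⟩
    rw [← LinearMap.toMatrix_toLin (Module.Basis.span hli) (Module.Basis.span hli)
      (jordanBlock k lam)]
    congr 1
    refine (Module.Basis.span hli).ext fun i => Subtype.ext ?_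
    rw [Matrix.toLin_self, LinearMap.coe_restrict_apply]
    simp only [Module.Basis.span_apply, Submodule.coe_sum, Submodule.coe_smul]
    exact hL i

theorem IsEigenChain.pow_apply_last {L : Module.End ℂ V} {lam : ℂ} {k : ℕ} {e : Fin k → V}
    (he : IsEigenChain L lam e) {t : ℕ} (ht : t < k) :
    ((L - lam • 1) ^ t) (e ⟨k - 1, by omega⟩) = e ⟨k - 1 - t, by omega⟩ := by
  induction t with
  | zero => simp
  | succ t ih =>
    rw [pow_succ', Module.End.mul_apply, ih (by omega)]
    simpa using he.2.2 ⟨k - 1 - (t + 1), by omega⟩ ⟨k - 1 - t, by omega⟩ (by simp; omega)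

theorem IsEigenChain.pow_apply_last_eq_zero {L : Module.End ℂ V} {lam : ℂ} {k : ℕ}
    {e : Fin k → V} (he : IsEigenChain L lam e) (hk : 0 < k) :
    ((L - lam • 1) ^ k) (e ⟨k - 1, by omega⟩) = 0 := by
  obtain ⟨k, rfl⟩ : ∃ k', k = k' + 1 := ⟨k - 1, by omega⟩
  rw [pow_succ', Module.End.mul_apply, he.pow_apply_last (by omega)]
  simpa using he.2.1 ⟨k + 1 - 1 - k, by omega⟩ (by simp)

theorem IsEigenChain.pow_apply_last_ne_zero {L : Module.End ℂ V} {lam : ℂ} {k : ℕ}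
    {e : Fin k → V} (he : IsEigenChain L lam e) (hk : 0 < k) :
    ((L - lam • 1) ^ (k - 1)) (e ⟨k - 1, by omega⟩) ≠ 0 := by
  rw [he.pow_apply_last (by omega)]
  exact he.1 _

/-- A chain is determined by its last vector `w`: the others are the images of `w` under powers of
`L - lam`. -/
theorem exists_isEigenChain_iff {L : Module.End ℂ V} {lam : ℂ} {k : ℕ} (hk : 0 < k) :
    (∃ e : Fin k → V, IsEigenChain L lam e) ↔
      ∃ w, ((L - lam • 1) ^ k) w = 0 ∧ ((L - lam • 1) ^ (k - 1)) w ≠ 0 := by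
  constructor
  · rintro ⟨e, he⟩
    exact ⟨_, he.pow_apply_last_eq_zero hk, he.pow_apply_last_ne_zero hk⟩
  · rintro ⟨w, h0, h1⟩
    refine ⟨fun i => ((L - lam • 1) ^ (k - 1 - i)) w, ?_, ?_, ?_⟩
    · intro i hi
      exact h1 (pow_apply_eq_zero_of_le (by omega) hi)
    · intro i hi
      have : ((L - lam • 1) ^ (k - 1 - i + 1)) w = 0 := pow_apply_eq_zero_of_le (by omega) h0
      rw [pow_succ', Module.End.mul_apply] at this
      simpa using this
    · intro i i' hi
      have h2 : k - 1 - i = k - 1 - i' + 1 := by omega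
      simp only [h2, pow_succ', Module.End.mul_apply]
      simp

theorem IsEigenChain.linearIndependent {L : Module.End ℂ V} {lam : ℂ} {k : ℕ} {e : Fin k → V}
    (he : IsEigenChain L lam e) : LinearIndependent ℂ e := by
  rcases Nat.eq_zero_or_pos k with rfl | hk
  · exact linearIndependent_empty_type
  have h := (linearIndependent_cyclic (he.pow_apply_last_eq_zero hk)
    (he.pow_apply_last_ne_zero hk)).comp Fin.rev Fin.rev_injective
  convert h using 1
  funext i
  simp only [Function.comp]
  rw [he.pow_apply_last (Fin.rev i).2]
  congr 1
  ext
  simp only [Fin.val_rev]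
  omega

/-- If `L` has a chain of length `n` with eigenvalue `lam`, then it has a Jordan subspace with that
eigenvalue and of dimension at least `n`, together with an invariant complement. -/
theorem exists_isJordanSubspace [FiniteDimensional ℂ V] {L : Module.End ℂ V} {lam : ℂ} {n : ℕ}
    {w : V} (hn : 0 < n) (hw0 : ((L - lam • 1) ^ n) w = 0)
    (hw1 : ((L - lam • 1) ^ (n - 1)) w ≠ 0) :
    ∃ S T : Submodule ℂ V, IsJordanSubspace L lam S ∧ n ≤ Module.finrank ℂ S ∧ IsCompl S T ∧
      ∀ x ∈ T, L x ∈ T := by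
  classical
  set N : Module.End ℂ V := L - lam • 1 with hN
  have hbound : ∀ k w, (N ^ k) w = 0 → (N ^ (k - 1)) w ≠ 0 → k ≤ Module.finrank ℂ V := by
    intro k w h0 h1
    simpa using (linearIndependent_cyclic h0 h1).fintype_card_le_finrank
  let p : ℕ → Prop := fun k => ∃ w, (N ^ k) w = 0 ∧ (N ^ (k - 1)) w ≠ 0
  -- The length `k` is maximal for this eigenvalue. If `N ^ (k - 1) v` were `N ^ k u`, then `u`
  -- would generate a chain of length `k + 1`; so a functional `ξ` can kill the range of `N ^ k`
  -- without killing `N ^ (k - 1) v`.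
  set k := Nat.findGreatest p (Module.finrank ℂ V) with hk
  have hpn : p n := ⟨w, hw0, hw1⟩
  have hnk : n ≤ k := Nat.le_findGreatest (hbound n w hw0 hw1) hpn
  obtain ⟨v, hv0, hv1⟩ : p k := Nat.findGreatest_spec (hbound n w hw0 hw1) hpn
  have hnot : (N ^ (k - 1)) v ∉ LinearMap.range (N ^ k) := by
    rintro ⟨u, hu⟩
    have h1 : (N ^ (k + 1)) u = 0 := by
      rw [pow_succ', Module.End.mul_apply, hu, ← Module.End.mul_apply, ← pow_succ',
        Nat.sub_add_cancel (by omega), hv0]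
    have h2 : (N ^ (k + 1 - 1)) u ≠ 0 := by simpa [hu] using hv1
    have := Nat.le_findGreatest (P := p) (hbound _ u h1 h2) ⟨u, h1, h2⟩
    omega
  obtain ⟨ξ, hξ, hξr⟩ := Submodule.exists_le_ker_of_notMem hnot
  have hξk : ∀ x, ξ ((N ^ k) x) = 0 := fun x => hξr ⟨x, rfl⟩
  -- The complement is the common kernel of the functionals `ξ ∘ N ^ i` with `i < k`. Its
  -- codimension is at most `k = dim S`, and it meets `S` trivially. It is invariant because `N`
  -- shifts these functionals and `ξ ∘ N ^ k = 0`.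
  let Φ : V →ₗ[ℂ] (Fin k → ℂ) := LinearMap.pi fun i => ξ ∘ₗ (N ^ (i : ℕ))
  have hT : ∀ x, x ∈ LinearMap.ker Φ ↔ ∀ i < k, ξ ((N ^ i) x) = 0 := by
    intro x
    rw [LinearMap.mem_ker]
    constructor
    · intro h i hi
      exact congrFun h ⟨i, hi⟩
    · intro h
      exact funext fun i => h i i.2
  set S := Submodule.span ℂ (Set.range fun i : Fin k => (N ^ (i : ℕ)) v) with hS
  have hfS : Module.finrank ℂ S = k := by
    simpa using finrank_span_eq_card (linearIndependent_cyclic hv0 hv1)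
  have hdisj : Disjoint S (LinearMap.ker Φ) := by
    rw [Submodule.disjoint_def]
    intro x hxS hxT
    obtain ⟨a, rfl⟩ := (Submodule.mem_span_range_iff_exists_fun ℂ).1 hxS
    rw [coeff_eq_zero_of_cyclic ξ hv0 hξ a ((hT _).1 hxT)]
    simp
  have hcompl : IsCompl S (LinearMap.ker Φ) := by
    refine ⟨hdisj, codisjoint_iff.2 (Submodule.eq_top_of_disjoint _ _ ?_ hdisj)⟩
    have h1 := Φ.finrank_range_add_finrank_ker
    have h2 : Module.finrank ℂ (LinearMap.range Φ) ≤ k := by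
      simpa using Submodule.finrank_le (LinearMap.range Φ)
    omega
  have hinv : ∀ x ∈ LinearMap.ker Φ, L x ∈ LinearMap.ker Φ := by
    intro x hx
    have hx' := (hT x).1 hx
    have h1 : N x ∈ LinearMap.ker Φ := by
      rw [hT]
      intro i hi
      rw [← Module.End.mul_apply, ← pow_succ]
      by_cases h : i + 1 < k
      · exact hx' _ h
      · rw [show i + 1 = k by omega]
        exact hξk x
    have h2 : L x = N x + lam • x := by simp [hN]
    rw [h2]
    exact Submodule.add_mem _ h1 (Submodule.smul_mem _ _ hx)
  exact ⟨S, _, isJordanSubspace_iff.2 ⟨⟨_, hcompl, hinv⟩, k, v, by omega, hv0, hv1, rfl⟩,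
    by omega, hcompl, hinv⟩

theorem IsJordanDecomposition.cons {L : Module.End ℂ V} {S T : Submodule ℂ V} {μ : ℂ}
    (hST : IsCompl S T) (hT : ∀ x ∈ T, L x ∈ T) (hS : IsJordanSubspace L μ S) {l : ℕ}
    {S' : Fin l → Submodule ℂ T} {ζ : Fin l → ℂ}
    (h : IsJordanDecomposition (L.restrict hT) S' ζ) :
    IsJordanDecomposition L (Fin.cons S fun k => (S' k).map T.subtype : Fin (l + 1) → _)
      (Fin.cons μ ζ : Fin (l + 1) → ℂ) := by
  obtain ⟨hint, hjor⟩ := h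
  rw [DirectSum.isInternal_submodule_iff_iSupIndep_and_iSup_eq_top] at hint
  obtain ⟨hind, hsup⟩ := hint
  have hinvS : ∀ x ∈ S, L x ∈ S := hS.2.1
  refine ⟨?_, ?_⟩
  · rw [DirectSum.isInternal_submodule_iff_iSupIndep_and_iSup_eq_top]
    constructor
    · rw [iSupIndep_iff_finsetSum_eq_zero_imp_eq_zero] at hind ⊢
      classical
      have huniv : ∀ v : Fin (l + 1) → V,
          (∀ i, v i ∈ (Fin.cons S fun k => (S' k).map T.subtype : Fin (l + 1) → _) i) →
          ∑ i, v i = 0 → ∀ i, v i = 0 := by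
        intro v hv hsum
        rw [Fin.sum_univ_succ] at hsum
        have hv0 : v 0 ∈ S := by simpa using hv 0
        have hvs : ∀ i : Fin l, ∃ u ∈ S' i, (u : V) = v i.succ := by
          intro i
          have := hv i.succ
          rw [Fin.cons_succ] at this
          exact this
        choose u hu huv using hvs
        have hsumT : ∑ i : Fin l, v i.succ ∈ T := Submodule.sum_mem _ fun i _ => by
          rw [← huv]; exact (u i).2
        have h0 : v 0 = 0 := by
          refine (Submodule.disjoint_def.1 hST.disjoint) _ hv0 ?_
          rw [eq_neg_of_add_eq_zero_left hsum]
          exact Submodule.neg_mem _ hsumT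
        have h1 : ∑ i, u i = 0 := by
          refine Subtype.ext ?_
          rw [h0, zero_add] at hsum
          simpa [huv] using hsum
        intro i
        refine Fin.cases h0 (fun i => ?_) i
        rw [← huv, hind Finset.univ u (fun i _ => hu i) h1 i (Finset.mem_univ i)]
        rfl
      -- A relation over a finite index set `s` becomes a relation over all indices after extension
      -- by zero.
      intro s v hv hsum i hi
      have := huniv (fun i => if i ∈ s then v i else 0) (fun i => by
        by_cases h : i ∈ s
        · simpa [h] using hv i h
        · simp [h]) (by simpa [Finset.sum_ite_mem] using hsum) i
      simpa [hi] using this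
    · rw [eq_top_iff, ← hST.sup_eq_top]
      refine sup_le (le_iSup (Fin.cons S fun k => (S' k).map T.subtype : Fin (l + 1) → _) 0) ?_
      have h1 : T = ⨆ i, (S' i).map T.subtype := by
        rw [← Submodule.map_iSup, hsup, Submodule.map_top, Submodule.range_subtype]
      exact h1.trans_le <| iSup_le fun i =>
        le_iSup (Fin.cons S fun k => (S' k).map T.subtype : Fin (l + 1) → _) i.succ
  · intro i
    refine Fin.cases ?_ (fun i => ?_) i
    · simpa using hS
    · rw [Fin.cons_succ, Fin.cons_succ]
      have hi := isJordanSubspace_iff.1 (hjor i)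
      obtain ⟨⟨C, hC, hCinv⟩, k, w, hk, hw0, hw1, hspan⟩ := hi
      have hpow : ∀ (j : ℕ) (x : T), (((L.restrict hT - ζ i • 1) ^ j) x : V) =
          ((L - ζ i • 1) ^ j) (x : V) := by
        intro j
        induction j with
        | zero => intro x; simp
        | succ j ih =>
          intro x
          rw [pow_succ, Module.End.mul_apply, ih, pow_succ, Module.End.mul_apply]
          simp
      -- An invariant complement inside `T` becomes one inside `V` when `S` is added.
      refine isJordanSubspace_iff.2 ⟨⟨C.map T.subtype ⊔ S, ⟨?_, ?_⟩, ?_⟩, k, (w : V), hk, ?_, ?_, ?_⟩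
      · rw [Submodule.disjoint_def]
        rintro _ ⟨x, hx, rfl⟩ hx2
        obtain ⟨_, ⟨y, hy, rfl⟩, s, hs, hxy⟩ := Submodule.mem_sup.1 hx2
        have hs0 : s = 0 := by
          refine (Submodule.disjoint_def.1 hST.disjoint) _ hs ?_
          have : s = T.subtype (x - y) := by rw [map_sub, ← hxy]; abel
          rw [this]
          exact (x - y).2
        rw [hs0, add_zero] at hxy
        have hxy' : y = x := Subtype.ext hxy
        subst hxy'
        rw [(Submodule.disjoint_def.1 hC.disjoint) _ hx hy]
        simp
      · rw [codisjoint_iff, ← sup_assoc, ← Submodule.map_sup, hC.sup_eq_top, Submodule.map_top,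
          Submodule.range_subtype, sup_comm]
        exact hST.sup_eq_top
      · intro x hx
        obtain ⟨_, ⟨y, hy, rfl⟩, s, hs, rfl⟩ := Submodule.mem_sup.1 hx
        rw [map_add]
        exact Submodule.add_mem_sup ⟨_, hCinv y hy, by simp⟩ (hinvS s hs)
      · rw [← hpow, hw0]; rfl
      · rw [← hpow]; simpa using hw1
      · rw [hspan, Submodule.map_span, ← Set.range_comp]
        congr 2
        funext j
        exact hpow j w

/-- Existence of the Jordan normal form. -/
theorem exists_isJordanDecomposition [FiniteDimensional ℂ V] (L : Module.End ℂ V) :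
    ∃ (l : ℕ) (S : Fin l → Submodule ℂ V) (ζ : Fin l → ℂ), IsJordanDecomposition L S ζ := by
  induction hd : Module.finrank ℂ V using Nat.strong_induction_on generalizing V with
  | _ d ih =>
    rcases subsingleton_or_nontrivial V with hV | hV
    · refine ⟨0, Fin.elim0, Fin.elim0, ?_, fun k => k.elim0⟩
      rw [DirectSum.isInternal_submodule_iff_iSupIndep_and_iSup_eq_top]
      exact ⟨iSupIndep_subsingleton _, Subsingleton.elim _ _⟩
    · obtain ⟨μ, hμ⟩ := Module.End.exists_eigenvalue L
      obtain ⟨w, hw⟩ := hμ.exists_hasEigenvector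
      -- An eigenvector is a chain of length one; the summand split off for it has positive
      -- dimension, so the induction descends to `T`.
      obtain ⟨S, T, hS, hn, hST, hT⟩ := exists_isJordanSubspace (L := L) (lam := μ) (n := 1) (w := w)
        one_pos (by simp [hw.apply_eq_smul]) (by simpa using hw.2)
      have hlt : Module.finrank ℂ T < d := by
        have := Submodule.finrank_add_eq_of_isCompl hST
        omega
      obtain ⟨l, S', ζ, h⟩ := ih _ hlt (L.restrict hT) rfl
      exact ⟨l + 1, _, _, h.cons hST hT hS⟩

theorem jordan_tfae [FiniteDimensional ℂ V] (L : Module.End ℂ V) (lam : ℂ) {n : ℕ} (hn : 0 < n) :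
    [ ∃ (l : ℕ) (S : Fin l → Submodule ℂ V) (ζ : Fin l → ℂ), IsJordanDecomposition L S ζ ∧
        ∃ k, ζ k = lam ∧ n ≤ Module.finrank ℂ (S k),
      ∃ S : Submodule ℂ V, IsJordanSubspace L lam S ∧ n ≤ Module.finrank ℂ S,
      LinearMap.ker (L - lam • 1) ⊓ LinearMap.range ((L - lam • 1) ^ (n - 1)) ≠ ⊥,
      ∃ ε : Fin n → V, IsEigenChain L lam ε ].TFAE := by
  tfae_have 1 → 2 := by
    rintro ⟨l, S, ζ, h, k, rfl, hk⟩
    exact ⟨S k, h.2 k, hk⟩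
  tfae_have 2 → 4 := by
    rintro ⟨S, hS, hnS⟩
    obtain ⟨_, k, w, hk, hw0, hw1, hspan⟩ := isJordanSubspace_iff.1 hS
    rw [exists_isEigenChain_iff hn]
    have hk' : Module.finrank ℂ S = k := by
      rw [hspan]
      simpa using finrank_span_eq_card (linearIndependent_cyclic hw0 hw1)
    -- The generator has length `k ≥ n`; applying `k - n` powers leaves a generator of length
    -- exactly `n`.
    refine ⟨((L - lam • 1) ^ (k - n)) w, ?_, ?_⟩
    · rw [← Module.End.mul_apply, ← pow_add, show n + (k - n) = k by omega, hw0]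
    · rw [← Module.End.mul_apply, ← pow_add, show n - 1 + (k - n) = k - 1 by omega]
      exact hw1
  tfae_have 4 → 1 := by
    intro h
    obtain ⟨w, hw0, hw1⟩ := (exists_isEigenChain_iff hn).1 h
    obtain ⟨S, T, hS, hnS, hST, hT⟩ := exists_isJordanSubspace hn hw0 hw1
    obtain ⟨l, S', ζ, h⟩ := exists_isJordanDecomposition (L.restrict hT)
    exact ⟨l + 1, _, _, h.cons hST hT hS, 0, rfl, hnS⟩
  tfae_have 3 ↔ 4 := by
    rw [exists_isEigenChain_iff hn, Submodule.ne_bot_iff]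
    constructor
    · rintro ⟨_, ⟨h1, w, rfl⟩, h2⟩
      refine ⟨w, ?_, h2⟩
      obtain ⟨n', rfl⟩ : ∃ n', n = n' + 1 := ⟨n - 1, by omega⟩
      rw [pow_succ', Module.End.mul_apply]
      exact h1
    · rintro ⟨w, h0, h1⟩
      refine ⟨_, ⟨?_, w, rfl⟩, h1⟩
      obtain ⟨n', rfl⟩ : ∃ n', n = n' + 1 := ⟨n - 1, by omega⟩
      rw [pow_succ', Module.End.mul_apply] at h0
      exact h0
  tfae_finish

end LinearAlgebra

/-! ### Compact operators without completeness -/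

/-- The surjectivity half of the Fredholm alternative, on a normed space that need not be
complete. -/
theorem IsCompactOperator.exists_sub_smul_eq {X : Type*} [NormedAddCommGroup X] [NormedSpace ℂ X]
    {T : X →ₗ[ℂ] X} (hT : IsCompactOperator T) {μ : ℂ} (hμ : μ ≠ 0)
    (hinj : ∀ x, T x = μ • x → x = 0) (y : X) : ∃ x, T x - μ • x = y := by
  let Y := UniformSpace.Completion X
  let ι : X →L[ℂ] Y := UniformSpace.Completion.toComplL
  have hι : ∀ x, ι x = (x : Y) := fun x => rfl
  have hdense : DenseRange ι := UniformSpace.Completion.denseRange_coe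
  have hui : IsUniformInducing ι := UniformSpace.Completion.isUniformInducing_coe X
  let T₀ : X →L[ℂ] X := ⟨T, hT.continuous⟩
  let S : Y →L[ℂ] Y := (ι.comp T₀).extend ι
  have hS : ∀ x, S (ι x) = ι (T x) := fun x => ContinuousLinearMap.extend_eq _ hdense hui x
  obtain ⟨A, hA, hTA⟩ := IsCompactOperator.image_closedBall_subset_compact (f := T) hT 2
  have hιA : IsCompact (ι '' A) := hA.image ι.continuous
  -- `S` extends `T` to the completion. Since `ι '' A` is compact, hence closed, density keeps the
  -- image of the ball inside it. So `S` is compact and takes all its values in `X`; eigenvectors of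
  -- `S` and solutions of the equation then lie in `X` as well.
  have hSA : ∀ x ∈ Metric.ball (0 : Y) 2, S x ∈ ι '' A := by
    intro x hx
    have h1 : x ∈ closure (Metric.ball (0 : Y) 2 ∩ Set.range ι) :=
      hdense.open_subset_closure_inter Metric.isOpen_ball hx
    have h2 : S x ∈ closure (S '' (Metric.ball (0 : Y) 2 ∩ Set.range ι)) :=
      image_closure_subset_closure_image S.continuous ⟨x, h1, rfl⟩
    refine hιA.isClosed.closure_subset_iff.2 ?_ h2
    rintro _ ⟨_, ⟨hu, u, rfl⟩, rfl⟩
    refine ⟨T u, hTA ⟨u, ?_, rfl⟩, (hS u).symm⟩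
    rw [mem_ball_zero_iff, hι, UniformSpace.Completion.norm_coe] at hu
    exact mem_closedBall_zero_iff.2 hu.le
  have hSrange : ∀ x, ∃ u, S x = ι u := by
    intro x
    set c : ℂ := ((‖x‖ + 1 : ℝ) : ℂ) with hc
    have hpos : 0 < ‖x‖ + 1 := by positivity
    have hc0 : c ≠ 0 := by
      rw [hc]; exact_mod_cast hpos.ne'
    obtain ⟨u, _, hu⟩ := hSA (c⁻¹ • x) (by
      rw [mem_ball_zero_iff, norm_smul, norm_inv, hc, Complex.norm_real, Real.norm_of_nonneg hpos.le,
        inv_mul_lt_iff₀ hpos]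
      linarith [norm_nonneg x])
    refine ⟨c • u, ?_⟩
    rw [map_smul, hu, map_smul, smul_inv_smul₀ hc0]
  have hScomp : IsCompactOperator S :=
    ⟨ι '' A, hιA, Filter.mem_of_superset (Metric.ball_mem_nhds 0 two_pos) hSA⟩
  have hιinj : Function.Injective ι := UniformSpace.Completion.coe_injective X
  rcases hScomp.hasEigenvalue_or_mem_resolventSet hμ with h | h
  · exfalso
    obtain ⟨v, hv⟩ := h.exists_hasEigenvector
    have hv1 : S v = μ • v := hv.apply_eq_smul
    obtain ⟨u, hu⟩ := hSrange v
    have hvu : v = ι (μ⁻¹ • u) := by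
      rw [map_smul, ← hu, hv1, inv_smul_smul₀ hμ]
    refine hv.2 ?_
    rw [hvu, hinj (μ⁻¹ • u) (hιinj ?_), map_zero]
    rw [← hS, ← hvu, hv1, ι.map_smul μ, ← hvu]
  · rw [spectrum.mem_resolventSet_iff, ContinuousLinearMap.isUnit_iff_bijective] at h
    obtain ⟨x, hx⟩ := h.2 (-ι y)
    have hx' : μ • x - S x = -ι y := by
      rw [← hx]
      simp [Algebra.algebraMap_eq_smul_one]
    obtain ⟨u, hu⟩ := hSrange x
    have hxu : x = ι (μ⁻¹ • (u - y)) := by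
      rw [map_smul, map_sub, ← hu, show S x - ι y = μ • x from ?_, inv_smul_smul₀ hμ]
      rw [sub_eq_add_neg, ← hx']; abel
    refine ⟨μ⁻¹ • (u - y), hιinj ?_⟩
    rw [map_sub, ← hS, ι.map_smul μ, ← hxu]
    rw [← neg_inj, ← hx']; abel

/-! ### Triangular linear substitutions in polynomials -/

section Triangular

open MvPolynomial

variable {n : ℕ}

/-- The linear form given by the `i`-th row of `A`. -/
noncomputable def rowForm (A : Matrix (Fin n) (Fin n) ℂ) (i : Fin n) : MvPolynomial (Fin n) ℂ :=
  ∑ j, C (A i j) * X j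

theorem eval_rowForm (A : Matrix (Fin n) (Fin n) ℂ) (i : Fin n) (z : Fin n → ℂ) :
    eval z (rowForm A i) = A.mulVec z i := by
  simp [rowForm, Matrix.mulVec, dotProduct]

theorem coeff_rowForm (A : Matrix (Fin n) (Fin n) ℂ) (i : Fin n) (β : Fin n →₀ ℕ) :
    (rowForm A i).coeff β = ∑ j, if Finsupp.single j 1 = β then A i j else 0 := by
  classical
  rw [rowForm, coeff_sum]
  refine Finset.sum_congr rfl fun j _ => ?_
  rw [coeff_C_mul, coeff_X]
  split_ifs <;> simp

theorem coeff_rowForm_single (A : Matrix (Fin n) (Fin n) ℂ) (i j : Fin n) :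
    (rowForm A i).coeff (Finsupp.single j 1) = A i j := by
  rw [coeff_rowForm, Finset.sum_eq_single j]
  · simp
  · intro b _ hb
    rw [if_neg]
    intro h
    exact hb (Finsupp.single_left_injective one_ne_zero h)
  · simp

/-- Row `i` involves only variables with index at least `i`, and earlier variables are larger in the
lexicographic order. -/
theorem degree_rowForm {A : Matrix (Fin n) (Fin n) ℂ} (hA : ∀ i j, j < i → A i j = 0)
    {i : Fin n} (hi : A i i ≠ 0) :
    MonomialOrder.lex.degree (rowForm A i) = Finsupp.single i 1 := by
  refine MonomialOrder.lex.toSyn.injective (le_antisymm ?_ ?_)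
  · rw [MonomialOrder.degree_le_iff]
    intro β hβ
    rw [mem_support_iff, coeff_rowForm] at hβ
    obtain ⟨j, _, hj⟩ := Finset.exists_ne_zero_of_sum_ne_zero hβ
    rw [ite_ne_right_iff] at hj
    obtain ⟨rfl, hj⟩ := hj
    have hij : i ≤ j := by
      by_contra h
      exact hj (hA i j (not_le.1 h))
    rw [MonomialOrder.lex_le_iff]
    exact Finsupp.Lex.single_le_iff.2 hij
  · refine MonomialOrder.le_degree ?_
    rw [mem_support_iff, coeff_rowForm_single]
    exact hi

/-- Leading terms multiply, so the substitution by `A` is triangular on monomials in the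
lexicographic order. This gives both its eigenvalues and the diagonal entries of the matrix of
`C_φ`. -/
theorem degree_leadingCoeff_prod_rowForm {A : Matrix (Fin n) (Fin n) ℂ}
    (hA : ∀ i j, j < i → A i j = 0) (hd : ∀ i, A i i ≠ 0) (α : Fin n →₀ ℕ) :
    MonomialOrder.lex.degree (∏ i, rowForm A i ^ α i) = α ∧
      (∏ i, rowForm A i ^ α i).coeff α = ∏ i, A i i ^ α i := by
  have hlc : ∀ i, MonomialOrder.lex.leadingCoeff (rowForm A i) = A i i := by
    intro i
    rw [MonomialOrder.leadingCoeff, degree_rowForm hA (hd i), coeff_rowForm_single]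
  have hne : ∀ i, rowForm A i ≠ 0 := by
    intro i h
    have := hlc i
    rw [h, MonomialOrder.leadingCoeff_zero] at this
    exact hd i this.symm
  have h1 : MonomialOrder.lex.degree (∏ i, rowForm A i ^ α i) = α := by
    rw [MonomialOrder.degree_prod fun i _ => pow_ne_zero _ (hne i)]
    simp_rw [MonomialOrder.degree_pow, degree_rowForm hA (hd _)]
    simp
  refine ⟨h1, ?_⟩
  have h2 := MonomialOrder.lex.coeff_prod_sum_degree (fun i => rowForm A i ^ α i) Finset.univ
  rw [← MonomialOrder.degree_prod fun i _ => pow_ne_zero _ (hne i), h1] at h2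
  rw [h2]
  refine Finset.prod_congr rfl fun i _ => ?_
  rw [MonomialOrder.leadingCoeff_pow, hlc]

/-- An eigenvalue of the substitution `q ↦ q ∘ A` for a triangular matrix `A` is a product of
powers of the diagonal entries. -/
theorem exists_eigenvalue_eq_prod {A : Matrix (Fin n) (Fin n) ℂ}
    (hA : ∀ i j, j < i → A i j = 0) (hd : ∀ i, A i i ≠ 0) {q : MvPolynomial (Fin n) ℂ}
    (hq : q ≠ 0) {μ : ℂ} (h : ∀ z : Fin n → ℂ, eval (A.mulVec z) q = μ * eval z q) :
    ∃ α ∈ q.support, μ = ∏ i, A i i ^ α i := by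
  have h1 : aeval (rowForm A) q = C μ * q := by
    refine MvPolynomial.funext fun z => ?_
    rw [map_mul, eval_C, ← h]
    have h2 : A.mulVec z = fun i => eval z (rowForm A i) := funext fun i => (eval_rowForm A i z).symm
    rw [h2]
    clear hq h
    induction q using MvPolynomial.induction_on with
    | C a => simp
    | add p q hp hq => rw [map_add, map_add, map_add, hp, hq]
    | mul_X p i hp => rw [map_mul, map_mul, map_mul, hp, aeval_X, eval_X]
  -- Compare coefficients at the leading monomial of `q`: every other monomial of `q` is smaller,
  -- and so is the leading monomial of its substitution.
  set α := MonomialOrder.lex.degree q with hα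
  have hαq : α ∈ q.support := MonomialOrder.degree_mem_support hq
  refine ⟨α, hαq, ?_⟩
  have h2 := congrArg (coeff α) h1
  rw [coeff_C_mul, aeval_def, eval₂_eq', coeff_sum, Finset.sum_eq_single α] at h2
  · rw [algebraMap_eq, coeff_C_mul, (degree_leadingCoeff_prod_rowForm hA hd α).2, mul_comm] at h2
    exact (mul_right_cancel₀ (mem_support_iff.1 hαq) h2).symm
  · intro β hβ hne
    have hlt : MonomialOrder.lex.toSyn (MonomialOrder.lex.degree (∏ i, rowForm A i ^ β i)) <
        MonomialOrder.lex.toSyn α := by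
      rw [(degree_leadingCoeff_prod_rowForm hA hd β).1]
      exact lt_of_le_of_ne (MonomialOrder.le_degree hβ)
        fun e => hne (MonomialOrder.lex.toSyn.injective e)
    rw [algebraMap_eq, coeff_C_mul, MonomialOrder.coeff_eq_zero_of_lt hlt, mul_zero]
  · exact fun h => absurd hαq h

end Triangular

/-! ### Orders of vanishing and Taylor expansions at the fixed point -/

section Taylor

open Asymptotics

variable {n : ℕ}

theorem isBigO_norm_pow_of_le {E : Type*} [NormedAddCommGroup E] {k l : ℕ} (h : k ≤ l) :
    (fun z : E => ‖z‖ ^ l) =O[𝓝 0] fun z => ‖z‖ ^ k := by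
  refine IsBigO.of_bound 1 ?_
  filter_upwards [Metric.closedBall_mem_nhds (0 : E) one_pos] with z hz
  rw [mem_closedBall_zero_iff] at hz
  rw [one_mul, norm_pow, norm_pow, norm_norm]
  exact pow_le_pow_of_le_one (norm_nonneg _) hz h

/-- Write the difference as `(f₁ - g₁) f₂ + g₁ (f₂ - g₂)`; each term gains one order over `a + b`.
-/
theorem isBigO_mul_sub_mul {E : Type*} [NormedAddCommGroup E] {f₁ f₂ g₁ g₂ : E → ℂ} {a b : ℕ}
    (h₁ : (fun z => f₁ z - g₁ z) =O[𝓝 0] fun z => ‖z‖ ^ (a + 1))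
    (h₂ : (fun z => f₂ z - g₂ z) =O[𝓝 0] fun z => ‖z‖ ^ (b + 1))
    (hg₁ : g₁ =O[𝓝 0] fun z => ‖z‖ ^ a) (hg₂ : g₂ =O[𝓝 0] fun z => ‖z‖ ^ b) :
    (fun z => f₁ z * f₂ z - g₁ z * g₂ z) =O[𝓝 0] fun z => ‖z‖ ^ (a + b + 1) := by
  have hf₂ : f₂ =O[𝓝 0] fun z => ‖z‖ ^ b := by
    simpa using (h₂.trans (isBigO_norm_pow_of_le b.le_succ)).add hg₂
  have h3 := (h₁.mul hf₂).add ((hg₁.mul h₂).congr_right fun z =>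
    (by ring : ‖z‖ ^ a * ‖z‖ ^ (b + 1) = ‖z‖ ^ (a + 1) * ‖z‖ ^ b))
  exact h3.congr (fun z => by ring) (fun z => by ring)

theorem isBigO_prod_pow {E ι : Type*} [NormedAddCommGroup E] {f g : ι → E → ℂ}
    (h : ∀ i, (fun z => f i z - g i z) =O[𝓝 0] fun z => ‖z‖ ^ 2)
    (hg : ∀ i, g i =O[𝓝 0] fun z => ‖z‖ ^ 1) (s : Finset ι) (α : ι → ℕ) :
    (fun z => ∏ i ∈ s, g i z ^ α i) =O[𝓝 0] (fun z => ‖z‖ ^ ∑ i ∈ s, α i) ∧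
    (fun z => ∏ i ∈ s, f i z ^ α i - ∏ i ∈ s, g i z ^ α i) =O[𝓝 0]
      fun z => ‖z‖ ^ (∑ i ∈ s, α i + 1) := by
  classical
  have hgp : ∀ i k, (fun z => g i z ^ k) =O[𝓝 0] fun z => ‖z‖ ^ k := fun i k =>
    ((hg i).pow k).congr_right fun z => by rw [pow_one]
  have hp : ∀ i k, (fun z => f i z ^ k - g i z ^ k) =O[𝓝 0] fun z => ‖z‖ ^ (k + 1) := by
    intro i k
    induction k with
    | zero => simpa using isBigO_zero _ _
    | succ k ih =>
      refine (isBigO_mul_sub_mul ih (h i) (hgp i k) (hg i)).congr_left fun z => ?_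
      rw [pow_succ, pow_succ]
  induction s using Finset.induction_on with
  | empty => simpa only [Finset.prod_empty, Finset.sum_empty, pow_zero, sub_self] using
      ⟨isBigO_const_const _ one_ne_zero _, isBigO_zero _ _⟩
  | insert i s hi ih =>
    simp_rw [Finset.prod_insert hi, Finset.sum_insert hi]
    refine ⟨((hgp i (α i)).mul ih.1).congr_right fun z => (pow_add _ _ _).symm,
      isBigO_mul_sub_mul (hp i _) ih.2 (hgp i _) ih.1⟩

theorem isBigO_toEuclideanCLM (A : Matrix (Fin n) (Fin n) ℂ) (i : Fin n) :
    (fun z : EuclideanSpace ℂ (Fin n) => A.mulVec z i) =O[𝓝 0] fun z => ‖z‖ ^ 1 := by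
  refine IsBigO.of_bound ‖Matrix.toEuclideanCLM (𝕜 := ℂ) A‖ (.of_forall fun z => ?_)
  rw [pow_one, norm_norm, ← Matrix.ofLp_toEuclideanCLM]
  exact (PiLp.norm_apply_le _ i).trans (ContinuousLinearMap.le_opNorm _ _)

theorem isBigO_prod_sub_prod {φ : EuclideanSpace ℂ (Fin n) → EuclideanSpace ℂ (Fin n)}
    {A : Matrix (Fin n) (Fin n) ℂ}
    (h : (fun z => φ z - Matrix.toEuclideanCLM (𝕜 := ℂ) A z) =O[𝓝 0] fun z => ‖z‖ ^ 2)
    (α : Fin n →₀ ℕ) :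
    (fun z => ∏ i, φ z i ^ α i - ∏ i, A.mulVec z i ^ α i) =O[𝓝 0]
      fun z => ‖z‖ ^ (α.degree + 1) := by
  rw [Finsupp.degree_eq_sum]
  refine (isBigO_prod_pow (f := fun i z => φ z i) (fun i => ?_) (isBigO_toEuclideanCLM A)
    Finset.univ α).2
  refine IsBigO.trans (IsBigO.of_bound 1 (.of_forall fun z => ?_)) h
  rw [one_mul, ← Matrix.ofLp_toEuclideanCLM]
  exact PiLp.norm_apply_le (φ z - Matrix.toEuclideanCLM (𝕜 := ℂ) A z) i

/-- The diagonal entries of the matrix of `C_φ`, for triangular `φ'(0)`. -/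
theorem isCompEntry_diag {φ : EuclideanSpace ℂ (Fin n) → EuclideanSpace ℂ (Fin n)}
    {A : Matrix (Fin n) (Fin n) ℂ} (hA : ∀ i j, j < i → A i j = 0) (hd : ∀ i, A i i ≠ 0)
    (h : (fun z => φ z - Matrix.toEuclideanCLM (𝕜 := ℂ) A z) =O[𝓝 0] fun z => ‖z‖ ^ 2)
    (α : Fin n →₀ ℕ) : IsCompEntry φ α α (∏ i, A i i ^ α i) := by
  refine ⟨∏ i, rowForm A i ^ α i, (degree_leadingCoeff_prod_rowForm hA hd α).2, ?_⟩
  refine (isBigO_prod_sub_prod h α).congr_left fun z => ?_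
  simp_rw [map_prod, map_pow, eval_rowForm]

/-- The diagonal of a homogeneous multilinear map is a homogeneous polynomial. -/
theorem exists_homogeneous_eval_eq {k : ℕ} (p : EuclideanSpace ℂ (Fin n) [×k]→L[ℂ] ℂ) :
    ∃ q : MvPolynomial (Fin n) ℂ, q.IsHomogeneous k ∧
      ∀ z : EuclideanSpace ℂ (Fin n), MvPolynomial.eval (fun i => z i) q = p fun _ => z := by
  refine ⟨∑ r : Fin k → Fin n, MvPolynomial.C (p fun i => EuclideanSpace.single (r i) 1) *
    ∏ i, MvPolynomial.X (r i), ?_, fun z => ?_⟩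
  · refine MvPolynomial.IsHomogeneous.sum _ _ _ fun r _ => ?_
    have h1 := MvPolynomial.IsHomogeneous.prod Finset.univ
      (fun i : Fin k => (MvPolynomial.X (r i) : MvPolynomial (Fin n) ℂ)) (fun _ => 1)
      (fun i _ => MvPolynomial.isHomogeneous_X _ _)
    have h2 := (MvPolynomial.isHomogeneous_C (Fin n)
      (p fun i => EuclideanSpace.single (r i) (1 : ℂ))).mul h1
    simpa using h2
  · have hz : z = ∑ j, z j • EuclideanSpace.single j (1 : ℂ) := by
      ext i
      simp [Finset.sum_apply, Pi.single_apply]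
    have h1 : (p fun _ => z) = p fun _ => ∑ j, z j • EuclideanSpace.single j (1 : ℂ) := by
      rw [← hz]
    rw [h1, ContinuousMultilinearMap.map_sum, map_sum]
    refine Finset.sum_congr rfl fun r _ => ?_
    rw [ContinuousMultilinearMap.map_smul_univ]
    simp [mul_comm]

theorem degree_eq_of_mem_support {k : ℕ} {q : MvPolynomial (Fin n) ℂ} (hq : q.IsHomogeneous k)
    {α : Fin n →₀ ℕ} (hα : α ∈ q.support) : α.degree = k := by
  rw [Finsupp.degree_eq_weight_one]
  exact hq (MvPolynomial.mem_support_iff.1 hα)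

theorem isBigO_comp_norm_pow {E : Type*} [NormedAddCommGroup E] {F : Type*} [NormedAddCommGroup F]
    {g : E → F} {φ : E → E} (hφ : φ =O[𝓝 0] fun z => ‖z‖) {k : ℕ}
    (hφ0 : Filter.Tendsto φ (𝓝 0) (𝓝 0)) (hg : g =O[𝓝 0] fun z => ‖z‖ ^ k) :
    (fun z => g (φ z)) =O[𝓝 0] fun z => ‖z‖ ^ k :=
  (hg.comp_tendsto hφ0).trans (hφ.norm_left.pow k)

/-- Used to replace `φ` by its linear part inside a form of degree `k`: telescoping bounds the
difference by a multiple of `(‖φ‖ + ‖ψ‖) ^ (k - 1) * ‖φ - ψ‖`, of order `k + 1`. -/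
theorem isBigO_multilinear_sub {E : Type*} [NormedAddCommGroup E] [NormedSpace ℂ E]
    {k : ℕ} (p : E [×k]→L[ℂ] ℂ) {φ ψ : E → E} (hφ : φ =O[𝓝 0] fun z => ‖z‖)
    (hψ : ψ =O[𝓝 0] fun z => ‖z‖) (h : (fun z => φ z - ψ z) =O[𝓝 0] fun z => ‖z‖ ^ 2) :
    (fun z => (p fun _ => φ z) - p fun _ => ψ z) =O[𝓝 0] fun z => ‖z‖ ^ (k + 1) := by
  rcases Nat.eq_zero_or_pos k with rfl | hk
  · have : ∀ z, ((p fun _ => φ z) - p fun _ => ψ z) = 0 := fun z => by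
      rw [sub_eq_zero]
      exact congrArg p (Subsingleton.elim _ _)
    simp_rw [this]
    exact isBigO_zero _ _
  obtain ⟨k, rfl⟩ : ∃ k', k = k' + 1 := ⟨k - 1, by omega⟩
  have hmax : (fun z => ‖φ z‖ + ‖ψ z‖) =O[𝓝 0] fun z => ‖z‖ := hφ.norm_left.add hψ.norm_left
  have h1 : (fun z => ‖p‖ * (k + 1 : ℕ) * (‖φ z‖ + ‖ψ z‖) ^ k * ‖φ z - ψ z‖) =O[𝓝 0]
      fun z => ‖z‖ ^ (k + 1 + 1) := by
    refine (((hmax.pow k).const_mul_left (‖p‖ * (k + 1 : ℕ))).mul h.norm_left).congr_right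
      fun z => by ring
  refine IsBigO.trans (IsBigO.of_bound 1 (.of_forall fun z => ?_)) h1
  rw [one_mul]
  refine (p.norm_image_sub_le _ _).trans ?_
  have h2 : ‖(fun _ : Fin (k + 1) => φ z)‖ = ‖φ z‖ := pi_norm_const _
  have h3 : ‖(fun _ : Fin (k + 1) => ψ z)‖ = ‖ψ z‖ := pi_norm_const _
  have h4 : ‖(fun _ : Fin (k + 1) => φ z) - fun _ => ψ z‖ = ‖φ z - ψ z‖ :=
    pi_norm_const (φ z - ψ z)
  rw [h2, h3, h4, Fintype.card_fin, Nat.add_sub_cancel, Real.norm_of_nonneg (by positivity)]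
  gcongr
  exact max_le (le_add_of_nonneg_right (norm_nonneg _)) (le_add_of_nonneg_left (norm_nonneg _))

theorem partialSum_succ_of_lower_eq_zero {E : Type*} [NormedAddCommGroup E] [NormedSpace ℂ E]
    {p : FormalMultilinearSeries ℂ E ℂ} {k : ℕ} (h : ∀ i < k, ∀ z, (p i fun _ => z) = 0) (z : E) :
    p.partialSum (k + 1) z = p k fun _ => z := by
  rw [FormalMultilinearSeries.partialSum, Finset.sum_range_succ,
    Finset.sum_eq_zero fun i hi => h i (Finset.mem_range.1 hi) z, zero_add]

/-- An eigenfunction of the composition with `φ` that vanishes to high order at the fixed point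
vanishes identically near it, when the eigenvalue is not an eigenvalue of `C_φ` on homogeneous
polynomials of high degree. -/
theorem eventually_eq_zero_of_comp_eq_smul
    {φ : EuclideanSpace ℂ (Fin n) → EuclideanSpace ℂ (Fin n)}
    {A : Matrix (Fin n) (Fin n) ℂ} (hA : ∀ i j, j < i → A i j = 0) (hd : ∀ i, A i i ≠ 0)
    (h : (fun z => φ z - Matrix.toEuclideanCLM (𝕜 := ℂ) A z) =O[𝓝 0] fun z => ‖z‖ ^ 2)
    (hφ : φ =O[𝓝 0] fun z => ‖z‖) (hφ0 : Filter.Tendsto φ (𝓝 0) (𝓝 0)) {K : ℕ} {μ : ℂ}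
    (hμ : ∀ α : Fin n →₀ ℕ, K < α.degree → μ ≠ ∏ i, A i i ^ α i)
    {f : EuclideanSpace ℂ (Fin n) → ℂ} (hf : AnalyticAt ℂ f 0)
    (hfK : f =O[𝓝 0] fun z => ‖z‖ ^ (K + 1)) (hcomp : ∀ᶠ z in 𝓝 0, f (φ z) = μ * f z) :
    ∀ᶠ z in 𝓝 0, f z = 0 := by
  obtain ⟨p, hp⟩ := hf
  -- The homogeneous parts of `f` vanish one after another. Only values on the diagonal matter,
  -- since these alone enter the power series.
  have hp0 : ∀ k, ∀ z, (p k fun _ => z) = 0 := by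
    intro k
    induction k using Nat.strong_induction_on with
    | _ k ih =>
      have h1 : (fun z => f z - p k fun _ => z) =O[𝓝 0] fun z => ‖z‖ ^ (k + 1) := by
        refine (hp.isBigO_sub_partialSum_pow (k + 1)).congr_left fun z => ?_
        rw [zero_add, partialSum_succ_of_lower_eq_zero ih]
      by_cases hkK : k ≤ K
      · have h2 := (hfK.trans (isBigO_norm_pow_of_le (Nat.succ_le_succ hkK))).sub h1
        have h3 : (fun z => p k fun _ => z) =O[𝓝 0] fun z => ‖z‖ ^ (k + 1) :=
          h2.congr_left fun z => by ring
        exact h3.continuousMultilinearMap_apply_eq_zero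
      · have hAO : (fun z => Matrix.toEuclideanCLM (𝕜 := ℂ) A z) =O[𝓝 0] fun z => ‖z‖ :=
          (ContinuousLinearMap.isBigO_id _ _).norm_right
        have h2 := isBigO_comp_norm_pow hφ hφ0 h1
        have h3 := isBigO_multilinear_sub (p k) hφ hAO h
        -- Beyond degree `K`, the degree-`k` part of `f ∘ φ = μ f` reads `p_k ∘ A = μ p_k`: the
        -- difference of the two sides is homogeneous of degree `k` and `O(‖z‖ ^ (k + 1))`, hence
        -- zero.
        have h4 : (fun z => μ * (p k fun _ => z) -
            p k fun _ => Matrix.toEuclideanCLM (𝕜 := ℂ) A z) =O[𝓝 0] fun z => ‖z‖ ^ (k + 1) := by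
          refine ((h2.add h3).sub (h1.const_mul_left μ)).congr' ?_ .rfl
          filter_upwards [hcomp] with z hz
          rw [hz]; ring
        have h5 := IsBigO.continuousMultilinearMap_apply_eq_zero
          (p := μ • p k - (p k).compContinuousLinearMap
            fun _ => Matrix.toEuclideanCLM (𝕜 := ℂ) A) (h4.congr_left fun z => by simp)
        obtain ⟨q, hq, hqe⟩ := exists_homogeneous_eval_eq (p k)
        have hq0 : q = 0 := by
          by_contra hne
          obtain ⟨α, hα, hα2⟩ := exists_eigenvalue_eq_prod hA hd hne (μ := μ) fun z => by
            have h6 := h5 (WithLp.toLp 2 z)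
            have h7 := hqe (WithLp.toLp 2 z)
            have h8 := hqe (Matrix.toEuclideanCLM (𝕜 := ℂ) A (WithLp.toLp 2 z))
            rw [Matrix.ofLp_toEuclideanCLM] at h8
            simp only [sub_apply, smul_apply,
              ContinuousMultilinearMap.compContinuousLinearMap_apply, smul_eq_mul] at h6
            rw [← h7, ← h8] at h6
            exact (sub_eq_zero.1 h6).symm
          refine hμ α ?_ hα2
          have h9 := degree_eq_of_mem_support hq hα
          omega
        intro z
        rw [← hqe, hq0, map_zero]
  filter_upwards [hp.eventually_hasSum] with z hz
  simp_rw [hp0, zero_add] at hz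
  exact hz.unique hasSum_zero

end Taylor

/-! ### Circle averages and rotation invariance of the measure -/

section Rotation

open Asymptotics

/-- Vanishing of a Taylor coefficient, in integral form. -/
theorem circleIntegral_eq_zero_of_isBigO {g : ℂ → ℂ} {c : ℂ} {d : ℕ} (hd : d ≠ 0)
    (hg : ∀ t ∈ Metric.closedBall (0 : ℂ) 1, DifferentiableAt ℂ g t)
    (hO : (fun t => g t - c) =O[𝓝 0] fun t => ‖t‖ ^ (d + 1)) :
    (∮ t in C(0, 1), (t - 0)⁻¹ • ((t ^ d)⁻¹ * g t)) = 0 := by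
  set I := ∮ t in C(0, 1), (t - 0)⁻¹ • ((t ^ d)⁻¹ * g t) with hI
  have hne : ∀ {r : ℝ}, 0 < r → ∀ t ∈ Metric.sphere (0 : ℂ) r, t ≠ 0 := by
    intro r hr t ht h
    rw [h, mem_sphere_zero_iff_norm, norm_zero] at ht
    exact hr.ne ht
  -- The circle can be shrunk to any radius `r`. The constant `c` contributes nothing because `d ≠
  -- 0`, and what remains of the integrand is bounded near `0`, so the integral is `O(r)`.
  have hIr : ∀ r : ℝ, 0 < r → r ≤ 1 →
      I = ∮ t in C(0, r), (t - 0)⁻¹ • ((t ^ d)⁻¹ * g t) := by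
    intro r hr hr1
    have hdiff : ∀ t ∈ Metric.closedBall (0 : ℂ) 1 \ Metric.ball 0 r,
        DifferentiableAt ℂ (fun t => (t ^ d)⁻¹ * g t) t := by
      rintro t ⟨ht, ht'⟩
      have ht0 : t ≠ 0 := by
        rintro rfl
        exact ht' (Metric.mem_ball_self hr)
      exact ((differentiableAt_id.pow d).inv (pow_ne_zero _ ht0)).mul (hg t ht)
    refine Complex.circleIntegral_sub_center_inv_smul_eq_of_differentiable_on_annulus_off_countable
      hr hr1 Set.countable_empty (fun t ht => (hdiff t ht).continuousAt.continuousWithinAt) ?_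
    rintro t ⟨⟨ht, ht'⟩, -⟩
    exact hdiff t ⟨Metric.ball_subset_closedBall ht, fun h => ht' (Metric.ball_subset_closedBall h)⟩
  have hsplit : ∀ r : ℝ, 0 < r → r ≤ 1 →
      I = ∮ t in C(0, r), t⁻¹ * ((t ^ d)⁻¹ * (g t - c)) := by
    intro r hr hr1
    have h1 : (∮ t in C(0, r), c * (t - 0) ^ (-(d + 1 : ℤ))) = 0 := by
      rw [circleIntegral.integral_const_mul,
        circleIntegral.integral_sub_zpow_of_ne (by omega), mul_zero]
    have hpow : ∀ t : ℂ, t ^ (-(d + 1 : ℤ)) = t⁻¹ * (t ^ d)⁻¹ := by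
      intro t
      rw [zpow_neg, ← mul_inv, mul_comm]
      congr 1
    rw [hIr r hr hr1]
    refine Eq.trans (b := (∮ t in C(0, r), (t - 0)⁻¹ • ((t ^ d)⁻¹ * g t)) -
      ∮ t in C(0, r), c * (t - 0) ^ (-(d + 1 : ℤ))) (by rw [h1, sub_zero]) ?_
    rw [← circleIntegral.integral_sub]
    · refine circleIntegral.integral_congr hr.le fun t _ => ?_
      simp only [sub_zero, smul_eq_mul, hpow]
      ring
    · refine ContinuousOn.circleIntegrable hr.le fun t ht => ?_
      have ht0 := hne hr t ht
      have hgt := (hg t (Metric.closedBall_subset_closedBall hr1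
        (Metric.sphere_subset_closedBall ht))).continuousAt
      refine ContinuousAt.continuousWithinAt ?_
      refine ((continuousAt_id.sub continuousAt_const).inv₀ (by simpa using ht0)).smul
        (((continuousAt_id.pow d).inv₀ (pow_ne_zero _ ht0)).mul hgt)
    · refine ContinuousOn.circleIntegrable hr.le fun t ht => ?_
      have ht0 := hne hr t ht
      refine ContinuousAt.continuousWithinAt ?_
      exact continuousAt_const.mul ((continuousAt_id.sub continuousAt_const).zpow₀ _
        (Or.inl (by simpa using ht0)))
  obtain ⟨M, hM, hO⟩ := hO.exists_pos
  rw [isBigOWith_iff] at hO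
  obtain ⟨ρ, hρ, hball⟩ := Metric.eventually_nhds_iff_ball.1 hO
  have hle : ∀ r : ℝ, 0 < r → r < min 1 ρ → ‖I‖ ≤ 2 * Real.pi * r * M := by
    intro r hr hrm
    rw [hsplit r hr (hrm.le.trans (min_le_left _ _))]
    refine circleIntegral.norm_integral_le_of_norm_le_const hr.le fun t ht => ?_
    have ht' := mem_sphere_zero_iff_norm.1 ht
    have h1 := hball t (by rw [mem_ball_zero_iff, ht']; exact hrm.trans_le (min_le_right _ _))
    rw [norm_mul, norm_mul, norm_inv, norm_inv, norm_pow, ht', ← mul_assoc, ← mul_inv,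
      ← pow_succ', inv_mul_le_iff₀ (by positivity)]
    rwa [norm_pow, norm_norm, ht', mul_comm] at h1
  have hlim : Filter.Tendsto (fun r : ℝ => 2 * Real.pi * r * M) (𝓝[>] 0) (𝓝 0) := by
    have : Filter.Tendsto (fun r : ℝ => 2 * Real.pi * r * M) (𝓝 0) (𝓝 (2 * Real.pi * 0 * M)) :=
      Continuous.tendsto (by fun_prop) 0
    rw [mul_zero, zero_mul] at this
    exact this.mono_left nhdsWithin_le_nhds
  have h0 : ‖I‖ ≤ 0 := by
    refine ge_of_tendsto hlim ?_
    filter_upwards [Ioo_mem_nhdsGT (lt_min one_pos hρ)] with r hr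
    exact hle r hr.1 hr.2
  exact norm_le_zero_iff.1 h0

variable {n : ℕ} {D : GL (Fin n) ℂ} {G : RadialWeight}

theorem smul_mem_ellipsoid_iff {u : ℂ} (hu : ‖u‖ = 1) {z : EuclideanSpace ℂ (Fin n)} :
    u • z ∈ ellipsoid D ↔ z ∈ ellipsoid D := by
  rw [mem_ellipsoid_iff, mem_ellipsoid_iff, map_smul, norm_smul, hu, one_mul]

theorem smul_mem_ellipsoid {u : ℂ} (hu : ‖u‖ ≤ 1) {z : EuclideanSpace ℂ (Fin n)}
    (hz : z ∈ ellipsoid D) : u • z ∈ ellipsoid D := by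
  rw [mem_ellipsoid_iff] at hz ⊢
  rw [map_smul, norm_smul]
  exact (mul_le_of_le_one_left (norm_nonneg _) hu).trans_lt hz

theorem zero_mem_ellipsoid : (0 : EuclideanSpace ℂ (Fin n)) ∈ ellipsoid D := by
  rw [mem_ellipsoid_iff, map_zero, norm_zero]
  exact one_pos

theorem measurePreserving_smul_volume {u : ℂ} (hu : ‖u‖ = 1) :
    MeasurePreserving (fun z : EuclideanSpace ℂ (Fin n) => u • z) := by
  have hu0 : u ≠ 0 := by
    rintro rfl
    simp at hu
  let e : EuclideanSpace ℂ (Fin n) ≃ₗᵢ[ℂ] EuclideanSpace ℂ (Fin n) :=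
    ⟨LinearEquiv.smulOfNeZero ℂ _ u hu0, fun z => by
      rw [LinearEquiv.smulOfNeZero_apply, norm_smul, hu, one_mul]⟩
  let e' : EuclideanSpace ℂ (Fin n) ≃ₗᵢ[ℝ] EuclideanSpace ℂ (Fin n) :=
    ⟨e.toLinearEquiv.restrictScalars ℝ, e.norm_map⟩
  exact e'.measurePreserving

/-- A unimodular scalar commutes with `D⁻¹` and preserves `|D⁻¹ w|`, on which both the ellipsoid and
the weight depend. For general `D`, coordinatewise rotations lack this property, so the symmetry
separates degrees only. -/
theorem measurePreserving_smul {u : ℂ} (hu : ‖u‖ = 1) :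
    MeasurePreserving (fun z : EuclideanSpace ℂ (Fin n) => u • z) (bergmanMeasure D G)
      (bergmanMeasure D G) := by
  have hm : Measurable fun z : EuclideanSpace ℂ (Fin n) => u • z := measurable_const_smul u
  have hE := (isOpen_ellipsoid D).measurableSet
  have hv : MeasurePreserving (fun z : EuclideanSpace ℂ (Fin n) => u • z)
      (volume.restrict (ellipsoid D)) (volume.restrict (ellipsoid D)) := by
    have := (measurePreserving_smul_volume (n := n) hu).restrict_preimage hE
    have e : (fun z : EuclideanSpace ℂ (Fin n) => u • z) ⁻¹' ellipsoid D = ellipsoid D :=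
      Set.ext fun z => smul_mem_ellipsoid_iff hu
    rwa [e] at this
  refine ⟨hm, Measure.ext fun s hs => ?_⟩
  rw [Measure.map_apply hm hs, bergmanMeasure, withDensity_apply _ (hm hs), withDensity_apply _ hs]
  have hw : ∀ z, ellipsoidWeight D G (u • z) = ellipsoidWeight D G z := by
    intro z
    rw [ellipsoidWeight, ellipsoidWeight, map_smul, norm_smul, hu, one_mul]
  have hwm : AEMeasurable (fun z => ENNReal.ofReal (ellipsoidWeight D G z))
      (volume.restrict (ellipsoid D)) :=
    ((ellipsoidWeight_continuousOn D G).aemeasurable hE).ennreal_ofReal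
  have h1 := (hv.restrict_preimage hs)
  have h2 := lintegral_map' (f := fun z => ENNReal.ofReal (ellipsoidWeight D G z))
    (g := fun z : EuclideanSpace ℂ (Fin n) => u • z)
    (μ := (volume.restrict (ellipsoid D)).restrict ((fun z => u • z) ⁻¹' s))
    (by rw [h1.map_eq]; exact hwm.restrict) hm.aemeasurable
  rw [h1.map_eq] at h2
  simp_rw [hw] at h2
  exact h2.symm

/-- A rotation average against the measure of the Bergman space: a function whose averages over
the circles `θ ↦ e^{iθ} z` vanish has integral zero. -/
theorem integral_eq_zero_of_rotation {F : EuclideanSpace ℂ (Fin n) → ℂ}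
    (hF : Integrable F (bergmanMeasure D G))
    (h : ∀ z ∈ ellipsoid D,
      ∫ θ in Set.Ioc 0 (2 * Real.pi), F (Complex.exp (θ * Complex.I) • z) = 0) :
    ∫ z, F z ∂bergmanMeasure D G = 0 := by
  set μ := bergmanMeasure D G with hμ
  set ν : Measure ℝ := volume.restrict (Set.Ioc 0 (2 * Real.pi)) with hν
  -- By this shear, the integral of `F(e^{iθ} z)` over `(θ, z)` equals that of `F(z)`, which is `2π
  -- ∫ F`. Integrating over `θ` first gives zero.
  have hmp : MeasurePreserving
      (fun p : ℝ × EuclideanSpace ℂ (Fin n) => (p.1, Complex.exp (p.1 * Complex.I) • p.2))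
      (ν.prod μ) (ν.prod μ) := by
    refine MeasurePreserving.skew_product (MeasurePreserving.id ν)
      (g := fun θ z => Complex.exp ((θ : ℂ) * Complex.I) • z) ?_ (.of_forall fun θ => ?_)
    · exact Continuous.measurable (by fun_prop)
    · exact (measurePreserving_smul (Complex.norm_exp_ofReal_mul_I θ)).map_eq
  have hint : Integrable (fun p : ℝ × EuclideanSpace ℂ (Fin n) => F p.2) (ν.prod μ) :=
    hF.comp_snd ν
  have hint2 : Integrable (fun p : ℝ × EuclideanSpace ℂ (Fin n) =>
      F (Complex.exp (p.1 * Complex.I) • p.2)) (ν.prod μ) := hmp.integrable_comp_of_integrable hint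
  have e1 : ∫ p, F (Complex.exp (p.1 * Complex.I) • p.2) ∂(ν.prod μ) =
      ∫ p, F p.2 ∂(ν.prod μ) := by
    have := integral_map (μ := ν.prod μ) hmp.measurable.aemeasurable
      (f := fun p : ℝ × EuclideanSpace ℂ (Fin n) => F p.2)
      (by rw [hmp.map_eq]; exact hint.aestronglyMeasurable)
    rw [hmp.map_eq] at this
    exact this.symm
  have e2 : ∫ p, F (Complex.exp (p.1 * Complex.I) • p.2) ∂(ν.prod μ) = 0 := by
    rw [integral_prod_symm _ hint2]
    have hae : ∀ᵐ z ∂μ, z ∈ ellipsoid D :=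
      (withDensity_absolutelyContinuous _ _).ae_le (ae_restrict_mem (isOpen_ellipsoid D).measurableSet)
    refine integral_eq_zero_of_ae ?_
    filter_upwards [hae] with z hz
    exact h z hz
  rw [e2, integral_fun_snd] at e1
  have hν0 : ν.real Set.univ ≠ 0 := by
    simp [hν, Real.pi_pos.le, Real.pi_ne_zero]
  exact (smul_eq_zero.1 e1.symm).resolve_left hν0

end Rotation

/-! ### Orthogonality to monomials in the Bergman space -/

namespace Bergman

open Asymptotics

variable {n : ℕ} {D : GL (Fin n) ℂ} {G : RadialWeight}

theorem inner_eq_integral (f g : Bergman D G) :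
    inner ℂ f g = ∫ z, inner ℂ (f z) (g z) ∂bergmanMeasure D G := by
  have h1 : inner ℂ f g = inner ℂ (toL2 D G f) (toL2 D G g) := rfl
  rw [h1, L2.inner_def]
  refine integral_congr_ae ?_
  filter_upwards [f.mem.2.1.coeFn_toLp, g.mem.2.1.coeFn_toLp] with z hf hg
  change inner ℂ ((f.mem.2.1.toLp f.1 : Lp ℂ 2 _) z) ((g.mem.2.1.toLp g.1 : Lp ℂ 2 _) z) = _
  rw [hf, hg]

theorem integrable_inner (f g : Bergman D G) :
    Integrable (fun z => inner ℂ (f z) (g z)) (bergmanMeasure D G) := by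
  refine (L2.integrable_inner (𝕜 := ℂ) (toL2 D G f) (toL2 D G g)).congr ?_
  filter_upwards [f.mem.2.1.coeFn_toLp, g.mem.2.1.coeFn_toLp] with z hf hg
  change inner ℂ ((f.mem.2.1.toLp f.1 : Lp ℂ 2 _) z) ((g.mem.2.1.toLp g.1 : Lp ℂ 2 _) z) = _
  rw [hf, hg]

theorem monomial_apply (α : Fin n →₀ ℕ) {z : EuclideanSpace ℂ (Fin n)} (hz : z ∈ ellipsoid D) :
    monomial D G α z = ∏ i, z i ^ α i :=
  Set.indicator_of_mem hz (fun z : EuclideanSpace ℂ (Fin n) => ∏ i, z i ^ α i)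

/-- On the circle through `z`, the conjugate monomial is a constant times `e^{-i|α|θ}`, so the
average picks out the Taylor coefficient of order `|α|` of `t ↦ f(tz)`, which vanishes. -/
theorem inner_monomial_eq_zero {f : Bergman D G} {c : ℂ} {α : Fin n →₀ ℕ} (hα : α.degree ≠ 0)
    (hf : (fun z => f z - c) =O[𝓝 0] fun z => ‖z‖ ^ (α.degree + 1)) :
    inner ℂ (monomial D G α) f = 0 := by
  rw [inner_eq_integral]
  refine integral_eq_zero_of_rotation (integrable_inner _ _) fun z hz => ?_
  have hcirc := circleIntegral_eq_zero_of_isBigO (g := fun t => f (t • z)) (c := c) hα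
    (fun t ht => by
      have h1 : AnalyticAt ℂ f.1 (t • z) :=
        f.mem.1 _ (smul_mem_ellipsoid (mem_closedBall_zero_iff.1 ht) hz)
      exact h1.differentiableAt.comp t (by fun_prop))
    (by
      have h0 : Filter.Tendsto (fun t : ℂ => t • z) (𝓝 0) (𝓝 0) := by
        have : Continuous fun t : ℂ => t • z := by fun_prop
        simpa using this.tendsto 0
      refine (hf.comp_tendsto h0).trans (IsBigO.of_bound (‖z‖ ^ (α.degree + 1))
        (.of_forall fun t => le_of_eq ?_))
      simp only [Function.comp, norm_smul, mul_pow, norm_mul, norm_pow, norm_norm]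
      ring)
  rw [circleIntegral, intervalIntegral.integral_of_le Real.two_pi_pos.le] at hcirc
  -- The factor `-I` cancels the `I` coming from the derivative of `circleMap`.
  have key : ∀ θ : ℝ, inner ℂ (monomial D G α (Complex.exp (θ * Complex.I) • z))
      (f (Complex.exp (θ * Complex.I) • z)) =
      ((starRingEnd ℂ) (∏ i, z i ^ α i) * -Complex.I) * (deriv (circleMap 0 1) θ •
        ((circleMap 0 1 θ - 0)⁻¹ • ((circleMap 0 1 θ ^ α.degree)⁻¹ * f (circleMap 0 1 θ • z)))) := by
    intro θ
    have hu : ‖Complex.exp (θ * Complex.I)‖ = 1 := Complex.norm_exp_ofReal_mul_I θ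
    have hc : circleMap 0 1 θ = Complex.exp (θ * Complex.I) := by simp [circleMap]
    rw [deriv_circleMap, hc, monomial_apply α ((smul_mem_ellipsoid_iff hu).2 hz)]
    set u := Complex.exp (θ * Complex.I) with hudef
    have hu0 : u ≠ 0 := Complex.exp_ne_zero _
    have hconj : (starRingEnd ℂ) u = u⁻¹ := by
      rw [Complex.inv_def, Complex.normSq_eq_norm_sq, hu]
      simp
    have hprod : ∏ i, (u • z) i ^ α i = u ^ α.degree * ∏ i, z i ^ α i := by
      rw [Finsupp.degree_eq_sum, ← Finset.prod_pow_eq_pow_sum, ← Finset.prod_mul_distrib]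
      refine Finset.prod_congr rfl fun i _ => ?_
      rw [PiLp.smul_apply, smul_eq_mul, mul_pow]
    rw [hprod, RCLike.inner_apply, map_mul, map_pow, hconj, inv_pow]
    simp only [sub_zero, smul_eq_mul]
    have hu1 : u * u⁻¹ = 1 := mul_inv_cancel₀ hu0
    linear_combination (f.1 (u • z) * (u ^ α.degree)⁻¹ * (starRingEnd ℂ) (∏ i, z i ^ α i)) *
      (u * u⁻¹ * Complex.I_sq - hu1)
  simp_rw [key]
  rw [integral_const_mul, hcirc, mul_zero]

theorem mem_polySpace_orthogonal {f : Bergman D G} {c : ℂ} {K : ℕ}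
    (hf : (fun z => f z - c) =O[𝓝 0] fun z => ‖z‖ ^ (K + 1)) : f ∈ (polySpace D G K)ᗮ := by
  rw [Submodule.mem_orthogonal]
  intro u hu
  induction hu using Submodule.span_induction with
  | mem x hx =>
    obtain ⟨α, ⟨h1, h2⟩, rfl⟩ := hx
    exact inner_monomial_eq_zero (c := c) (by omega)
      (hf.trans (isBigO_norm_pow_of_le (by omega)))
  | zero => exact inner_zero_left _
  | add x y _ _ hx hy => rw [inner_add_left, hx, hy, add_zero]
  | smul a x _ hx => rw [inner_smul_left, hx, mul_zero]

end Bergman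

/-! ### The complement of `P𝓗` and the composition operator -/

namespace Bergman

open Asymptotics

variable {n : ℕ} {D : GL (Fin n) ℂ} {G : RadialWeight}

theorem sub_apply (f g : Bergman D G) (z : EuclideanSpace ℂ (Fin n)) : (f - g) z = f z - g z := rfl

theorem smul_apply (c : ℂ) (f : Bergman D G) (z : EuclideanSpace ℂ (Fin n)) :
    (c • f) z = c * f z := rfl

theorem sum_apply {ι : Type*} (s : Finset ι) (f : ι → Bergman D G)
    (z : EuclideanSpace ℂ (Fin n)) : (∑ i ∈ s, f i : Bergman D G) z = ∑ i ∈ s, f i z := by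
  have := congrFun (map_sum (bergmanSubmodule D G).subtype f s) z
  rw [Finset.sum_apply] at this
  exact this

theorem ext_of_eqOn {f g : Bergman D G} (h : ∀ z ∈ ellipsoid D, f z = g z) : f = g := by
  refine Subtype.ext (funext fun z => ?_)
  by_cases hz : z ∈ ellipsoid D
  · exact h z hz
  · rw [f.mem.2.2 z hz, g.mem.2.2 z hz]

theorem ellipsoid_mem_nhds : ellipsoid D ∈ 𝓝 (0 : EuclideanSpace ℂ (Fin n)) :=
  (isOpen_ellipsoid D).mem_nhds zero_mem_ellipsoid

/-- The Taylor polynomial of order `K`. -/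
theorem exists_taylor (f : Bergman D G) (K : ℕ) :
    ∃ q ∈ polySpace D G K, (fun z => (f - q) z - f 0) =O[𝓝 0] fun z => ‖z‖ ^ (K + 1) := by
  obtain ⟨p, hp⟩ := f.mem.1 0 zero_mem_ellipsoid
  choose q hq hqe using fun i => exists_homogeneous_eval_eq (p i)
  let Q : ℕ → Bergman D G := fun i => ∑ α ∈ (q i).support, (q i).coeff α • monomial D G α
  have hQ : ∀ i, ∀ z ∈ ellipsoid D, Q i z = p i fun _ => z := by
    intro i z hz
    rw [sum_apply, ← hqe, MvPolynomial.eval_eq']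
    exact Finset.sum_congr rfl fun α _ => by rw [smul_apply, monomial_apply α hz]
  -- The shift leaves out degree `0`, since `polySpace` contains no constants; the constant term is
  -- the subtracted `f 0`.
  refine ⟨∑ i ∈ Finset.range K, Q (i + 1), ?_, ?_⟩
  · refine Submodule.sum_mem _ fun i hi => Submodule.sum_mem _ fun α hα =>
      Submodule.smul_mem _ _ (Submodule.subset_span ⟨α, ?_, rfl⟩)
    have := degree_eq_of_mem_support (hq _) hα
    rw [Finset.mem_range] at hi
    constructor <;> omega
  · refine (hp.isBigO_sub_partialSum_pow (K + 1)).congr' ?_ .rfl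
    filter_upwards [ellipsoid_mem_nhds (D := D)] with z hz
    rw [sub_apply, sum_apply, FormalMultilinearSeries.partialSum, Finset.sum_range_succ',
      hp.coeff_zero, zero_add, Finset.sum_congr rfl fun i _ => hQ (i + 1) z hz]
    ring

/-- If `f` is orthogonal to `polySpace`, so is its Taylor polynomial without constant term, being
`f` minus an orthogonal remainder; lying in `polySpace` too, it is zero. -/
theorem mem_polySpace_orthogonal_iff {f : Bergman D G} {K : ℕ} :
    f ∈ (polySpace D G K)ᗮ ↔ (fun z => f z - f 0) =O[𝓝 0] fun z => ‖z‖ ^ (K + 1) := by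
  refine ⟨fun hf => ?_, mem_polySpace_orthogonal⟩
  obtain ⟨q, hq, hO⟩ := exists_taylor f K
  have h1 := Submodule.sub_mem _ hf (mem_polySpace_orthogonal hO)
  rw [sub_sub_cancel] at h1
  have hq0 : q = 0 := inner_self_eq_zero.1 (Submodule.inner_right_of_mem_orthogonal hq h1)
  rw [hq0, sub_zero] at hO
  exact hO

theorem proj_eq_zero_iff {f : Bergman D G} {K : ℕ} :
    proj D G K f = 0 ↔ f ∈ (polySpace D G K)ᗮ :=
  Submodule.orthogonalProjectionOnto_eq_zero_iff

theorem proj_coe {K : ℕ} (x : polySpace D G K) : proj D G K (x : Bergman D G) = x :=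
  Submodule.orthogonalProjectionOnto_mem_subspace_eq_self x

section compOp

variable {φ : EuclideanSpace ℂ (Fin n) → EuclideanSpace ℂ (Fin n)}
  {hφ : ∀ f : Bergman D G, MemBergman D G ((ellipsoid D).indicator fun z => f (φ z))}

theorem compOp_apply (f : Bergman D G) {z : EuclideanSpace ℂ (Fin n)} (hz : z ∈ ellipsoid D) :
    compOp φ hφ f z = f (φ z) :=
  Set.indicator_of_mem hz (fun z => f (φ z))

theorem compOp_mem_orthogonal (hφ0 : φ 0 = 0) (hφO : φ =O[𝓝 0] fun z => ‖z‖)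
    (hφt : Filter.Tendsto φ (𝓝 0) (𝓝 0)) {K : ℕ} {f : Bergman D G}
    (hf : f ∈ (polySpace D G K)ᗮ) : compOp φ hφ f ∈ (polySpace D G K)ᗮ := by
  rw [mem_polySpace_orthogonal_iff] at hf ⊢
  refine (isBigO_comp_norm_pow hφO hφt hf).congr' ?_ .rfl
  filter_upwards [ellipsoid_mem_nhds (D := D)] with z hz
  rw [compOp_apply f hz, compOp_apply f zero_mem_ellipsoid, hφ0]

/-- The complement is invariant, so the operator is block triangular and the part of `f` outside
`P𝓗` does not affect the projection. -/
theorem proj_compOp (hφ0 : φ 0 = 0) (hφO : φ =O[𝓝 0] fun z => ‖z‖)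
    (hφt : Filter.Tendsto φ (𝓝 0) (𝓝 0)) (K : ℕ) (f : Bergman D G) :
    proj D G K (compOp φ hφ f) = corner (compOp φ hφ) K (proj D G K f) := by
  have h1 : f - (proj D G K f : Bergman D G) ∈ (polySpace D G K)ᗮ := by
    rw [← proj_eq_zero_iff, map_sub, proj_coe, sub_self]
  have h2 := proj_eq_zero_iff.2 (compOp_mem_orthogonal (hφ := hφ) hφ0 hφO hφt h1)
  rw [map_sub, map_sub, sub_eq_zero] at h2
  exact h2

theorem prod_pow_single (x : Fin n → ℂ) (i : Fin n) (k : ℕ) :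
    ∏ l, x l ^ (Finsupp.single i k) l = x i ^ k := by
  rw [Finset.prod_eq_single i]
  · simp
  · intro b _ hb
    rw [Finsupp.single_eq_of_ne hb, pow_zero]
  · simp

theorem monomial_ne_zero (i : Fin n) (k : ℕ) : monomial D G (Finsupp.single i k) ≠ 0 := by
  intro h
  have h0 : Filter.Tendsto (fun t : ℂ => t • EuclideanSpace.single i (1 : ℂ)) (𝓝 0) (𝓝 0) := by
    have : Continuous fun t : ℂ => t • EuclideanSpace.single i (1 : ℂ) := by fun_prop
    simpa using this.tendsto 0
  have h1 : ∀ᶠ t : ℂ in 𝓝[≠] 0, t • EuclideanSpace.single i (1 : ℂ) ∈ ellipsoid D :=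
    (h0.eventually ellipsoid_mem_nhds).filter_mono nhdsWithin_le_nhds
  obtain ⟨t, ht, ht0⟩ := (h1.and self_mem_nhdsWithin).exists
  have h2 := monomial_apply (G := G) (Finsupp.single i k) ht
  rw [h, prod_pow_single] at h2
  have h3 : (0 : ℂ) = (t • EuclideanSpace.single i (1 : ℂ)).ofLp i ^ k := h2
  exact pow_ne_zero k ht0 (by simpa using h3.symm)

/-- If `C_φ` is compact then `1` is not an eigenvalue of `φ'(0)`, where the eigenvector is a
coordinate form. -/
theorem ne_one_of_isCompactOperator {A : Matrix (Fin n) (Fin n) ℂ}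
    (h : (fun z => φ z - Matrix.toEuclideanCLM (𝕜 := ℂ) A z) =O[𝓝 0] fun z => ‖z‖ ^ 2)
    (hm : Set.MapsTo φ (ellipsoid D) (ellipsoid D))
    (hc : IsCompactOperator (compOp φ hφ)) {i : Fin n} {μ : ℂ}
    (hi : ∀ z : Fin n → ℂ, A.mulVec z i = μ * z i) : μ ≠ 1 := by
  rintro rfl
  let e : ℕ → Bergman D G := fun k => monomial D G (Finsupp.single i (k + 1))
  have hdeg : ∀ k, (Finsupp.single i (k + 1)).degree = k + 1 := fun k => Finsupp.degree_single _ _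
  have he : ∀ k, ∀ z ∈ ellipsoid D, e k z = z i ^ (k + 1) := fun k z hz => by
    rw [monomial_apply _ hz, prod_pow_single]
  -- With `μ = 1`, the power `z_i ^ (k + 1)` and its composition with `φ` have the same lowest-order
  -- part; their difference vanishes to higher order and is orthogonal to `e k`.
  have h1 : ∀ k, inner ℂ (e k) (compOp φ hφ (e k) - e k) = 0 := by
    intro k
    refine inner_monomial_eq_zero (c := 0) (by rw [hdeg]; omega) ?_
    refine (isBigO_prod_sub_prod h (Finsupp.single i (k + 1))).congr' ?_ .rfl
    filter_upwards [ellipsoid_mem_nhds (D := D)] with z hz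
    have h2 : compOp φ hφ (e k) z = ∏ l, φ z l ^ (Finsupp.single i (k + 1)) l := by
      rw [compOp_apply _ hz, monomial_apply _ (hm hz)]
    rw [sub_zero, sub_apply, h2, he k z hz, prod_pow_single (A.mulVec z), hi, one_mul]
  have h2 : ∀ k l, k < l → inner ℂ (e k) (e l) = 0 := by
    intro k l hkl
    refine inner_monomial_eq_zero (c := 0) (by rw [hdeg]; omega) ?_
    rw [hdeg]
    refine IsBigO.trans (IsBigO.of_bound 1 ?_) (isBigO_norm_pow_of_le (show k + 1 + 1 ≤ l + 1 by omega))
    filter_upwards [ellipsoid_mem_nhds (D := D)] with z hz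
    rw [sub_zero, he l z hz, one_mul, norm_pow, norm_pow, norm_norm]
    exact pow_le_pow_left₀ (norm_nonneg _) (PiLp.norm_apply_le _ i) _
  have hne : ∀ k, ‖e k‖ ≠ 0 := fun k => norm_ne_zero_iff.2 (monomial_ne_zero i (k + 1))
  let g : ℕ → Bergman D G := fun k => ((‖e k‖⁻¹ : ℝ) : ℂ) • e k
  have hg : Orthonormal ℂ g := by
    refine ⟨fun k => ?_, fun k l hkl => ?_⟩
    · rw [norm_smul, Complex.norm_real, norm_inv, norm_norm, inv_mul_cancel₀ (hne k)]
    · change inner ℂ (g k) (g l) = 0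
      rw [inner_smul_left, inner_smul_right]
      rcases lt_or_gt_of_ne hkl with hlt | hgt
      · rw [h2 k l hlt]; simp
      · rw [inner_eq_zero_symm.1 (h2 l k hgt)]; simp
  have hgC : ∀ k, inner ℂ (g k) (compOp φ hφ (g k)) = 1 := by
    intro k
    have h3 : compOp φ hφ (g k) = g k + ((‖e k‖⁻¹ : ℝ) : ℂ) • (compOp φ hφ (e k) - e k) := by
      rw [map_smul, smul_sub]; abel
    rw [h3, inner_add_right, inner_self_eq_norm_sq_to_K, hg.1, inner_smul_left, inner_smul_right, h1]
    simp
  obtain ⟨A, hA, hCA⟩ := IsCompactOperator.image_closedBall_subset_compact (f := compOp φ hφ) hc 1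
  obtain ⟨x, -, ψ, hψ, hx⟩ := hA.tendsto_subseq (x := fun k => compOp φ hφ (g k))
    fun k => hCA ⟨g k, mem_closedBall_zero_iff.2 (hg.1 k).le, rfl⟩
  -- By Bessel's inequality, orthonormal vectors tend weakly to zero. Along the subsequence where
  -- `C_φ g_k` converges to `x`, this forces `⟨g_k, C_φ g_k⟩ → 0`, although it is always `1`.
  have h4 : Filter.Tendsto (fun k => inner ℂ (g (ψ k)) x) Filter.atTop (𝓝 0) := by
    have h5 := (hg.inner_products_summable x).tendsto_atTop_zero.comp hψ.tendsto_atTop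
    rw [tendsto_zero_iff_norm_tendsto_zero]
    simpa [Function.comp_def] using h5.sqrt
  have h5 : Filter.Tendsto (fun k => inner ℂ (g (ψ k)) (compOp φ hφ (g (ψ k)) - x))
      Filter.atTop (𝓝 0) := by
    refine squeeze_zero_norm (fun k => ?_) (tendsto_iff_norm_sub_tendsto_zero.1 hx)
    refine (norm_inner_le_norm _ _).trans_eq ?_
    rw [hg.1, one_mul]
    rfl
  have h6 := h5.add h4
  simp_rw [← inner_add_right, sub_add_cancel, hgC, add_zero] at h6
  exact one_ne_zero (tendsto_nhds_unique tendsto_const_nhds h6)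

/-- Constants lie in the complement and have eigenvalue `1`, hence the condition `μ ≠ 1`: it gives
`f 0 = 0`. The local result then applies, and the identity theorem extends it to the connected
ellipsoid. -/
theorem eq_zero_of_compOp_eq_smul {A : Matrix (Fin n) (Fin n) ℂ}
    (hA : ∀ i j, j < i → A i j = 0) (hd : ∀ i, A i i ≠ 0)
    (h : (fun z => φ z - Matrix.toEuclideanCLM (𝕜 := ℂ) A z) =O[𝓝 0] fun z => ‖z‖ ^ 2)
    (hφ0 : φ 0 = 0) (hφO : φ =O[𝓝 0] fun z => ‖z‖)
    (hφt : Filter.Tendsto φ (𝓝 0) (𝓝 0)) {K : ℕ} {μ : ℂ} (hμ1 : μ ≠ 1)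
    (hμ : ∀ α : Fin n →₀ ℕ, K < α.degree → μ ≠ ∏ i, A i i ^ α i) {f : Bergman D G}
    (hf : f ∈ (polySpace D G K)ᗮ) (hfμ : compOp φ hφ f = μ • f) : f = 0 := by
  have hz : ∀ z ∈ ellipsoid D, f (φ z) = μ * f z := by
    intro z hz
    rw [← compOp_apply (hφ := hφ) f hz, hfμ, smul_apply]
  have hf0 : f 0 = 0 := by
    have h1 := hz 0 zero_mem_ellipsoid
    rw [hφ0] at h1
    have h2 : (μ - 1) * f 0 = 0 := by linear_combination -h1
    exact (mul_eq_zero.1 h2).resolve_left (sub_ne_zero.2 hμ1)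
  rw [mem_polySpace_orthogonal_iff, hf0] at hf
  simp_rw [sub_zero] at hf
  have h1 := eventually_eq_zero_of_comp_eq_smul hA hd h hφO hφt hμ (f.mem.1 0 zero_mem_ellipsoid) hf
    (Filter.mem_of_superset ellipsoid_mem_nhds hz)
  have hconn : IsPreconnected (ellipsoid D) :=
    (convex_ball (0 : EuclideanSpace ℂ (Fin n)) 1).isPreconnected.image _
      (ContinuousLinearMap.continuous _).continuousOn
  refine ext_of_eqOn fun z hz => ?_
  exact f.mem.1.eqOn_zero_of_preconnected_of_eventuallyEq_zero hconn zero_mem_ellipsoid h1 hz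

/-- The transposed block gives `f_i ∘ φ = lam f_i + f_{i+1}`, the chain relation with the indices
reversed. -/
theorem isBlockSolution_iff {k : ℕ} {lam : ℂ} {F : Fin k → Bergman D G} :
    IsBlockSolution φ lam F ↔
      (∀ i : Fin k, (i : ℕ) = 0 → compOp φ hφ (F i.rev) - lam • F i.rev = 0) ∧
      ∀ i i' : Fin k, (i' : ℕ) = (i : ℕ) + 1 →
        compOp φ hφ (F i'.rev) - lam • F i'.rev = F i.rev := by
  have h1 : ∀ z i, (jordanBlock k lam).transpose.mulVec (fun i => F i z) i =
      lam * F i z + if h : (i : ℕ) + 1 < k then F ⟨i + 1, h⟩ z else 0 := by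
    intro z i
    rw [← smul_eq_mul, ← sum_jordanBlock_smul lam (fun i => F i z) i]
    rfl
  constructor
  · intro h
    have h2 : ∀ z ∈ ellipsoid D, ∀ i, F i (φ z) =
        lam * F i z + if h : (i : ℕ) + 1 < k then F ⟨i + 1, h⟩ z else 0 := fun z hz i =>
      (congrFun (h z hz) i).trans (h1 z i)
    constructor
    · intro i hi
      refine ext_of_eqOn fun z hz => ?_
      rw [sub_apply, smul_apply, compOp_apply _ hz, h2 z hz,
        dif_neg (by rw [Fin.val_rev]; omega), add_zero, sub_self]
      rfl
    · intro i i' hi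
      refine ext_of_eqOn fun z hz => ?_
      have h3 : ((i'.rev : Fin k) : ℕ) + 1 = i.rev := by
        rw [Fin.val_rev, Fin.val_rev]; omega
      have h4 : ((i'.rev : Fin k) : ℕ) + 1 < k := by rw [h3]; exact i.rev.2
      rw [sub_apply, smul_apply, compOp_apply _ hz, h2 z hz, dif_pos h4, add_sub_cancel_left]
      exact congrArg (fun l => F l z) (Fin.ext h3 : (⟨(i'.rev : ℕ) + 1, h4⟩ : Fin k) = i.rev)
  · rintro ⟨h0, hs⟩ z hz
    funext i
    rw [h1]
    split_ifs with h
    · have h3 := hs (Fin.rev ⟨i + 1, h⟩) i.rev (by simp only [Fin.val_rev]; omega)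
      rw [Fin.rev_rev, Fin.rev_rev] at h3
      rw [← h3, sub_apply, smul_apply, compOp_apply _ hz]
      ring
    · have h3 := h0 i.rev (by rw [Fin.val_rev]; omega)
      rw [Fin.rev_rev, sub_eq_zero] at h3
      rw [← compOp_apply (hφ := hφ) _ hz, h3, smul_apply, add_zero]

end compOp

end Bergman

/-! ### Lifting chains from the corner to the operator -/

namespace Bergman

open Asymptotics

section Lifting

variable {n : ℕ} {D : GL (Fin n) ℂ} {G : RadialWeight}
  {C : Bergman D G →ₗ[ℂ] Bergman D G} {K : ℕ} {μ : ℂ}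

/-- The equation `C f - μ f = g` has a solution with prescribed projection, provided that the
projected equation holds. -/
theorem exists_lift (hC : IsCompactOperator C)
    (hproj : ∀ f, proj D G K (C f) = corner C K (proj D G K f)) (hμ : μ ≠ 0)
    (hinj : ∀ f ∈ (polySpace D G K)ᗮ, C f = μ • f → f = 0)
    {ε : polySpace D G K} {g : Bergman D G} (hg : proj D G K g = corner C K ε - μ • ε) :
    ∃ f, proj D G K f = ε ∧ C f - μ • f = g := by
  have hinv : ∀ f ∈ (polySpace D G K)ᗮ, C f ∈ (polySpace D G K)ᗮ := by
    intro f hf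
    rw [← proj_eq_zero_iff] at hf ⊢
    rw [hproj, hf, map_zero]
  have hr : g - (C ε - μ • (ε : Bergman D G)) ∈ (polySpace D G K)ᗮ := by
    rw [← proj_eq_zero_iff, map_sub, map_sub, map_smul, hproj, proj_coe, hg, sub_self]
  -- Taking `ε` itself as the solution leaves an error in the complement; there `C - μ` is
  -- injective, so the Fredholm alternative supplies a correction `q` that does not change the
  -- projection.
  obtain ⟨q, hq⟩ := (hC.restrict hinv (Submodule.isClosed_orthogonal _)).exists_sub_smul_eq hμ
    (fun x hx => Subtype.ext (hinj x x.2 (congrArg Subtype.val hx))) ⟨_, hr⟩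
  have hq' : C q - μ • (q : Bergman D G) = g - (C ε - μ • (ε : Bergman D G)) :=
    congrArg Subtype.val hq
  refine ⟨ε + q, ?_, ?_⟩
  · rw [map_add, proj_coe, proj_eq_zero_iff.2 q.2, add_zero]
  · rw [map_add, smul_add, add_sub_add_comm, hq']
    abel

/-- The only issue is that the projections are nonzero. A vanishing projection makes the preceding
one vanish, down to the first vector, an eigenvector, which would then lie in the complement. -/
theorem isEigenChain_proj (hproj : ∀ f, proj D G K (C f) = corner C K (proj D G K f))
    (hinj : ∀ f ∈ (polySpace D G K)ᗮ, C f = μ • f → f = 0) {k : ℕ} {F : Fin k → Bergman D G}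
    (hF : ∀ i, F i ≠ 0) (h0 : ∀ i : Fin k, (i : ℕ) = 0 → C (F i) - μ • F i = 0)
    (hs : ∀ i i' : Fin k, (i' : ℕ) = (i : ℕ) + 1 → C (F i') - μ • F i' = F i) :
    IsEigenChain (corner C K) μ fun i => proj D G K (F i) := by
  have hs' : ∀ i i' : Fin k, (i' : ℕ) = (i : ℕ) + 1 →
      corner C K (proj D G K (F i')) - μ • proj D G K (F i') = proj D G K (F i) := by
    intro i i' hi
    rw [← hproj, ← map_smul, ← map_sub, hs i i' hi]
  refine ⟨?_, fun i hi => ?_, hs'⟩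
  · rintro ⟨i, hi⟩
    induction i with
    | zero =>
      intro h
      exact hF ⟨0, hi⟩ (hinj _ (proj_eq_zero_iff.1 h) (sub_eq_zero.1 (h0 ⟨0, hi⟩ rfl)))
    | succ i ih =>
      intro h
      have h1 := hs' ⟨i, by omega⟩ ⟨i + 1, hi⟩ rfl
      simp only at h
      rw [h, map_zero, smul_zero, sub_zero] at h1
      exact ih (by omega) h1.symm
  · rw [← hproj, ← map_smul, ← map_sub, h0 i hi, map_zero]

theorem exists_lift_chain (hC : IsCompactOperator C)
    (hproj : ∀ f, proj D G K (C f) = corner C K (proj D G K f)) (hμ : μ ≠ 0)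
    (hinj : ∀ f ∈ (polySpace D G K)ᗮ, C f = μ • f → f = 0) {k : ℕ}
    {ε : Fin k → polySpace D G K} (hε : IsEigenChain (corner C K) μ ε) :
    ∃ F : Fin k → Bergman D G, (∀ i, proj D G K (F i) = ε i) ∧
      (∀ i : Fin k, (i : ℕ) = 0 → C (F i) - μ • F i = 0) ∧
      ∀ i i' : Fin k, (i' : ℕ) = (i : ℕ) + 1 → C (F i') - μ • F i' = F i := by
  -- Moving the compatibility condition inside the existential makes the chosen lift a total
  -- function, so the chain can be built by recursion on `ℕ`. Indices beyond `k` carry arbitrary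
  -- values.
  have hlift : ∀ (x : polySpace D G K) (g : Bergman D G), ∃ f,
      proj D G K g = corner C K x - μ • x → proj D G K f = x ∧ C f - μ • f = g := by
    intro x g
    by_cases hg : proj D G K g = corner C K x - μ • x
    · obtain ⟨f, hf⟩ := exists_lift hC hproj hμ hinj hg
      exact ⟨f, fun _ => hf⟩
    · exact ⟨0, fun h => absurd h hg⟩
  choose s hs using hlift
  let x : ℕ → polySpace D G K := fun t => if h : t < k then ε ⟨t, h⟩ else 0
  have hx : ∀ i : Fin k, x i = ε i := fun i => dif_pos i.2
  let f : ℕ → Bergman D G := fun t => Nat.rec (s (x 0) 0) (fun t g => s (x (t + 1)) g) t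
  have hf0 : 0 < k → proj D G K (f 0) = x 0 ∧ C (f 0) - μ • f 0 = 0 := by
    intro hk
    refine hs _ _ ?_
    rw [map_zero, hx ⟨0, hk⟩]
    exact (hε.2.1 ⟨0, hk⟩ rfl).symm
  have hfs : ∀ t, t + 1 < k → proj D G K (f t) = x t →
      proj D G K (f (t + 1)) = x (t + 1) ∧ C (f (t + 1)) - μ • f (t + 1) = f t := by
    intro t ht h
    refine hs _ _ ?_
    have h1 : proj D G K (f t) = corner C K (x (t + 1)) - μ • x (t + 1) := by
      rw [h, hx ⟨t, by omega⟩, hx ⟨t + 1, ht⟩]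
      exact (hε.2.2 ⟨t, by omega⟩ ⟨t + 1, ht⟩ rfl).symm
    exact h1
  have hP : ∀ t, t < k → proj D G K (f t) = x t := by
    intro t
    induction t with
    | zero => exact fun h => (hf0 h).1
    | succ t ih => exact fun h => (hfs t h (ih (by omega))).1
  refine ⟨fun i => f i, fun i => (hP i i.2).trans (hx i), fun i hi => ?_, fun i i' hi => ?_⟩
  · have h1 := hf0 (by have := i.2; omega)
    rw [← hi] at h1
    exact h1.2
  · have h1 := hfs i (by have := i'.2; omega) (hP i i.2)
    rw [← hi] at h1
    exact h1.2

/-- Inductively, the difference of two lifts of the same vector lies in the complement and satisfies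
the eigenvalue equation. -/
theorem lift_chain_unique (hinj : ∀ f ∈ (polySpace D G K)ᗮ, C f = μ • f → f = 0) {k : ℕ}
    {F F' : Fin k → Bergman D G} (hP : ∀ i, proj D G K (F' i) = proj D G K (F i))
    (h0 : ∀ i : Fin k, (i : ℕ) = 0 → C (F i) - μ • F i = 0)
    (hs : ∀ i i' : Fin k, (i' : ℕ) = (i : ℕ) + 1 → C (F i') - μ • F i' = F i)
    (h0' : ∀ i : Fin k, (i : ℕ) = 0 → C (F' i) - μ • F' i = 0)
    (hs' : ∀ i i' : Fin k, (i' : ℕ) = (i : ℕ) + 1 → C (F' i') - μ • F' i' = F' i) : F' = F := by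
  have key : ∀ i : Fin k, C (F' i) - μ • F' i = C (F i) - μ • F i → F' i = F i := by
    intro i hi
    refine sub_eq_zero.1 (hinj _ ?_ ?_)
    · rw [← proj_eq_zero_iff, map_sub, hP, sub_self]
    · rw [map_sub, smul_sub, ← sub_eq_zero, sub_sub_sub_comm, hi, sub_self]
  funext ⟨i, hi⟩
  induction i with
  | zero => exact key _ ((h0' _ rfl).trans (h0 _ rfl).symm)
  | succ i ih =>
    refine key _ ?_
    rw [hs' ⟨i, by omega⟩ _ rfl, hs ⟨i, by omega⟩ _ rfl, ih]

end Lifting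

end Bergman

/-! ### Entries of the block diagonal Jordan matrix -/

section JordanMatrix

variable {m : ℕ} (d : Fin m → ℕ) (lam : Fin m → ℂ)

theorem jordanMatrix_apply (a b : Σ j, Fin (d j)) :
    jordanMatrix d lam (finSigmaFinEquiv a) (finSigmaFinEquiv b) =
      if a = b then lam a.1 else
        if (finSigmaFinEquiv b : ℕ) = finSigmaFinEquiv a + 1 ∧ a.1 = b.1 then 1 else 0 := by
  rcases a with ⟨j, r⟩
  rcases b with ⟨j', s⟩
  rw [jordanMatrix, Matrix.reindex_apply, Matrix.submatrix_apply, Equiv.symm_apply_apply,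
    Equiv.symm_apply_apply]
  by_cases hj : j = j'
  · subst hj
    rw [Matrix.blockDiagonal'_apply_eq, Matrix.transpose_apply, jordanBlock, Matrix.of_apply]
    simp only [finSigmaFinEquiv_apply, and_true, Sigma.mk.injEq, heq_eq_eq, true_and, add_assoc,
      Nat.add_left_cancel_iff, eq_comm (a := s)]
  · rw [Matrix.blockDiagonal'_apply_ne _ _ _ hj]
    simp [hj]

theorem jordanMatrix_upper {i j : Fin (∑ j, d j)} (h : j < i) : jordanMatrix d lam i j = 0 := by
  obtain ⟨a, rfl⟩ := finSigmaFinEquiv.surjective i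
  obtain ⟨b, rfl⟩ := finSigmaFinEquiv.surjective j
  have h' : (finSigmaFinEquiv b : ℕ) < finSigmaFinEquiv a := h
  rw [jordanMatrix_apply, if_neg, if_neg]
  · omega
  · rintro rfl
    exact h'.ne rfl

theorem jordanMatrix_diag (a : Σ j, Fin (d j)) :
    jordanMatrix d lam (finSigmaFinEquiv a) (finSigmaFinEquiv a) = lam a.1 := by
  rw [jordanMatrix_apply, if_pos rfl]

/-- The last row of an upper triangular Jordan block has only its diagonal entry. This supplies the
coordinate form needed in `ne_one_of_isCompactOperator`. -/
theorem jordanMatrix_mulVec_last {j : Fin m} (hd : 0 < d j) (z : Fin (∑ j, d j) → ℂ) :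
    (jordanMatrix d lam).mulVec z (finSigmaFinEquiv ⟨j, ⟨d j - 1, by omega⟩⟩) =
      lam j * z (finSigmaFinEquiv ⟨j, ⟨d j - 1, by omega⟩⟩) := by
  set a : Σ j, Fin (d j) := ⟨j, ⟨d j - 1, by omega⟩⟩ with ha
  rw [Matrix.mulVec, dotProduct, Finset.sum_eq_single (finSigmaFinEquiv a)]
  · rw [jordanMatrix_diag]
  · intro i _ hi
    obtain ⟨b, rfl⟩ := finSigmaFinEquiv.surjective i
    rw [jordanMatrix_apply, if_neg (fun e => hi (congrArg _ e.symm)), if_neg, zero_mul]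
    rintro ⟨h1, h2⟩
    rcases b with ⟨j', s⟩
    change j = j' at h2
    subst h2
    rw [ha, finSigmaFinEquiv_apply, finSigmaFinEquiv_apply] at h1
    have := s.2
    simp only at h1
    omega
  · simp

end JordanMatrix

/-! ### Assembly of the theorem -/

theorem isBigO_sub_fderiv {E : Type*} [NormedAddCommGroup E] [NormedSpace ℂ E] {φ : E → E}
    (hφ : AnalyticAt ℂ φ 0) (hφ0 : φ 0 = 0) {L : E →L[ℂ] E} (hL : HasFDerivAt φ L 0) :
    (fun z => φ z - L z) =O[𝓝 0] fun z => ‖z‖ ^ 2 := by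
  obtain ⟨p, hp⟩ := hφ
  have h1 := hp.hasFDerivAt.unique hL
  refine (hp.isBigO_sub_partialSum_pow 2).congr_left fun z => ?_
  rw [FormalMultilinearSeries.partialSum, Finset.sum_range_succ, Finset.sum_range_one,
    hp.coeff_zero, hφ0, zero_add, zero_add, ← h1, continuousMultilinearCurryFin1_apply]
  congr 2

theorem mainTheorem8 {m : ℕ} (d : Fin m → ℕ) (hd : ∀ j, 0 < d j) (lam : Fin m → ℂ)
    (D : GL (Fin (∑ j, d j)) ℂ) (G : RadialWeight)
    (φ : EuclideanSpace ℂ (Fin (∑ j, d j)) → EuclideanSpace ℂ (Fin (∑ j, d j)))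
    (hφ_analytic : AnalyticOnNhd ℂ φ (ellipsoid D))
    (hφ_maps : Set.MapsTo φ (ellipsoid D) (ellipsoid D))
    (hφ_zero : φ 0 = 0)
    (hφ_deriv : HasFDerivAt φ (Matrix.toEuclideanCLM (𝕜 := ℂ) (jordanMatrix d lam)) 0)
    (h_inv : IsUnit (jordanMatrix d lam))
    (hφ_mem : ∀ f : Bergman D G, MemBergman D G ((ellipsoid D).indicator fun z => f (φ z)))
    (h_compact : IsCompactOperator (Bergman.compOp φ hφ_mem))
    (K : ℕ)
    (hK : ∀ (i : Fin m) (α : Fin (∑ j, d j) →₀ ℕ), K < α.degree → ¬ IsCompEntry φ α α (lam i))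
    (j : Fin m) :
    [ -- a block solution with linearly independent components exists
      ∃ F : Fin (d j) → Bergman D G,
        LinearIndependent ℂ F ∧ Bergman.IsBlockSolution φ (lam j) F,
      -- `U` has a Jordan decomposition with a large enough summand of eigenvalue `lam j`
      ∃ (l : ℕ) (S : Fin l → Submodule ℂ (Bergman.polySpace D G K)) (ζ : Fin l → ℂ),
        IsJordanDecomposition (Bergman.corner (Bergman.compOp φ hφ_mem) K) S ζ ∧
        ∃ k, ζ k = lam j ∧ d j ≤ Module.finrank ℂ (S k),
      -- `U` has a large enough Jordan subspace of eigenvalue `lam j`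
      ∃ S : Submodule ℂ (Bergman.polySpace D G K),
        IsJordanSubspace (Bergman.corner (Bergman.compOp φ hφ_mem) K) (lam j) S ∧
        d j ≤ Module.finrank ℂ S,
      -- an eigenvector of `U` in the range of the power `d j - 1` of `U - lam j`
      LinearMap.ker (Bergman.corner (Bergman.compOp φ hφ_mem) K - lam j • 1) ⊓
        LinearMap.range ((Bergman.corner (Bergman.compOp φ hφ_mem) K - lam j • 1) ^ (d j - 1)) ≠ ⊥,
      -- `U` has a chain of length `d j` with eigenvalue `lam j`
      ∃ ε : Fin (d j) → Bergman.polySpace D G K,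
        IsEigenChain (Bergman.corner (Bergman.compOp φ hφ_mem) K) (lam j) ε ].TFAE ∧
    -- the projected components of a solution, in reverse order, form such a chain
    (∀ F : Fin (d j) → Bergman D G,
      LinearIndependent ℂ F → Bergman.IsBlockSolution φ (lam j) F →
      IsEigenChain (Bergman.corner (Bergman.compOp φ hφ_mem) K) (lam j)
        (fun i => Bergman.proj D G K (F i.rev))) ∧
    -- every such chain comes from exactly one solution, and its components are independent
    (∀ ε : Fin (d j) → Bergman.polySpace D G K,
      IsEigenChain (Bergman.corner (Bergman.compOp φ hφ_mem) K) (lam j) ε →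
      ∃ F : Fin (d j) → Bergman D G,
        (LinearIndependent ℂ F ∧ Bergman.IsBlockSolution φ (lam j) F ∧
          ∀ i, Bergman.proj D G K (F i.rev) = ε i) ∧
        ∀ F' : Fin (d j) → Bergman D G, Bergman.IsBlockSolution φ (lam j) F' →
          (∀ i, Bergman.proj D G K (F' i.rev) = ε i) → F' = F) := by
  have hup : ∀ i i', i' < i → jordanMatrix d lam i i' = 0 := fun i i' => jordanMatrix_upper d lam
  have hdiag : ∀ i, jordanMatrix d lam i i ≠ 0 := by
    have hdet := ((Matrix.isUnit_iff_isUnit_det _).1 h_inv).ne_zero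
    rw [Matrix.det_of_isUpperTriangular (fun i i' h => hup i i' h)] at hdet
    exact fun i => Finset.prod_ne_zero_iff.1 hdet i (Finset.mem_univ i)
  have hlam0 : lam j ≠ 0 := by
    have := hdiag (finSigmaFinEquiv ⟨j, ⟨0, hd j⟩⟩)
    rwa [jordanMatrix_diag] at this
  have hO := isBigO_sub_fderiv (hφ_analytic 0 zero_mem_ellipsoid) hφ_zero hφ_deriv
  have hφO : φ =O[𝓝 0] fun z => ‖z‖ := by
    simpa [hφ_zero] using hφ_deriv.isBigO_sub.norm_right
  have hφt : Filter.Tendsto φ (𝓝 0) (𝓝 0) := by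
    simpa [hφ_zero] using hφ_deriv.continuousAt.tendsto
  have hlam1 : lam j ≠ 1 := Bergman.ne_one_of_isCompactOperator hO hφ_maps h_compact
    (jordanMatrix_mulVec_last d lam (hd j))
  have hproj := Bergman.proj_compOp (hφ := hφ_mem) hφ_zero hφO hφt K
  have hinj : ∀ f ∈ (Bergman.polySpace D G K)ᗮ, Bergman.compOp φ hφ_mem f = lam j • f → f = 0 :=
    fun f => Bergman.eq_zero_of_compOp_eq_smul hup hdiag hO hφ_zero hφO hφt hlam1
      -- It is enough that the product of diagonal entries is one admissible value of the entry `(α,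
      -- α)`; uniqueness of Taylor coefficients is not needed.
      fun α hα h => hK j α hα (h ▸ isCompEntry_diag hup hdiag hO α)
  have hsol_chain : ∀ F : Fin (d j) → Bergman D G,
      LinearIndependent ℂ F → Bergman.IsBlockSolution φ (lam j) F →
      IsEigenChain (Bergman.corner (Bergman.compOp φ hφ_mem) K) (lam j)
        (fun i => Bergman.proj D G K (F i.rev)) := by
    intro F hF hsol
    obtain ⟨h0, hs⟩ := (Bergman.isBlockSolution_iff (hφ := hφ_mem)).1 hsol
    exact Bergman.isEigenChain_proj (F := fun i => F i.rev) hproj hinj (fun i => hF.ne_zero _) h0 hs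
  have hchain_sol : ∀ ε : Fin (d j) → Bergman.polySpace D G K,
      IsEigenChain (Bergman.corner (Bergman.compOp φ hφ_mem) K) (lam j) ε →
      ∃ F : Fin (d j) → Bergman D G,
        (LinearIndependent ℂ F ∧ Bergman.IsBlockSolution φ (lam j) F ∧
          ∀ i, Bergman.proj D G K (F i.rev) = ε i) ∧
        ∀ F' : Fin (d j) → Bergman D G, Bergman.IsBlockSolution φ (lam j) F' →
          (∀ i, Bergman.proj D G K (F' i.rev) = ε i) → F' = F := by
    intro ε hε
    obtain ⟨F, hP, h0, hs⟩ := Bergman.exists_lift_chain h_compact hproj hlam0 hinj hε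
    refine ⟨fun i => F i.rev, ⟨?_, ?_, fun i => by simp only [Fin.rev_rev, hP]⟩, fun F' hF' hP' => ?_⟩
    · have hli : LinearIndependent ℂ F := by
        -- Independence is inherited from the projections, which form a chain and are therefore
        -- independent.
        refine LinearIndependent.of_comp (Bergman.proj D G K) ?_
        rw [show Bergman.proj D G K ∘ F = ε from funext hP]
        exact hε.linearIndependent
      exact hli.comp Fin.rev Fin.rev_injective
    · rw [Bergman.isBlockSolution_iff (hφ := hφ_mem)]
      simp only [Fin.rev_rev]
      exact ⟨h0, hs⟩
    · obtain ⟨h0', hs'⟩ := (Bergman.isBlockSolution_iff (hφ := hφ_mem)).1 hF'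
      have h1 := Bergman.lift_chain_unique hinj (F := F) (F' := fun i => F' i.rev)
        (fun i => by rw [hP', hP]) h0 hs h0' hs'
      funext i
      simp only [← h1, Fin.rev_rev]
  refine ⟨?_, hsol_chain, hchain_sol⟩
  refine (List.tfae_cons_of_mem (b := ∃ ε : Fin (d j) → Bergman.polySpace D G K,
    IsEigenChain (Bergman.corner (Bergman.compOp φ hφ_mem) K) (lam j) ε) (by simp)).2
    ⟨⟨?_, ?_⟩, jordan_tfae _ _ (hd j)⟩
  · rintro ⟨F, hF, hsol⟩
    exact ⟨_, hsol_chain F hF hsol⟩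
  · rintro ⟨ε, hε⟩
    obtain ⟨F, ⟨hF, hsol, -⟩, -⟩ := hchain_sol ε hε
    exact ⟨F, hF, hsol⟩
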